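/- Let $d\ge 1$. Consider the infinite spin chain with a copy of $\mathbb{C}^d$ at each site $i\in\mathbb{Z}$. Let $\mathcal{B}_0$ be the space of traceless operators on $\mathbb{C}^d$. A formal operator is a family $\Phi=\sum_A\Phi(A)$, indexed by the finite sets $A\subset\mathbb{Z}$, with $\Phi(A)\in\mathcal{B}_0^{\otimes A}$ (and $\mathcal{B}_0^{\otimes\emptyset}=\mathbb{C}$). It is Hermitian if every $\Phi(A)$ is. It is at most $r$-local if every $A$ with $\Phi(A)\neq 0$ is contained in $r$ contiguous sites, and local if this holds for some finite $r$. Let $\mathcal{T}$ be the translation by one site, so that $\mathcal{T}(\Phi)(A)$ is $\Phi(A+1)$ transported to $A$; $\Phi$ is translation-invariant if $\mathcal{T}(\Phi)=\Phi$. For a finite set $B\subset\mathbb{Z}$ put $\Phi|_B=\sum_{A\subset B}\Phi(A)$, an operator on $(\mathbb{C}^d)^{\otimes B}$. For local $\Phi$ the commutator $[\Phi,\Psi]$ is the formal operator whose component at $A$ is the $\mathcal{B}_0^{\otimes A}$-component of $[\Phi|_B,\Psi|_B]$ for all sufficiently large finite $B\supset A$. Let $\hat H$ be a local, Hermitian,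 translation-invariant formal operator (for instance a Hamiltonian with nearest-neighbour interactions and on-site potentials). Let $\hat B$ be a local Hermitian formal operator, not necessarily translation-invariant (for instance one that is at most two-local). Put $\hat Q^{(2)}=\hat H$ and $\hat Q^{(n+1)}=[\hat B,\hat Q^{(n)}]$ for $n\ge 2$, and $\hat X=\mathcal{T}(\hat B)-\hat B$. Suppose that $[\hat H,\hat Q^{(3)}]=0$, that $\hat X$ is translation-invariant, and that $[\hat X,[\hat B,\hat X]]=0$. Then for all $m,n\ge 2$ the operator $\hat Q^{(n)}$ is translation-invariant, $[\hat Q^{(m)},\hat Q^{(n)}]=0$, and $[\hat X,\hat Q^{(n)}]=0$. -/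

import Mathlib

open scoped Matrix

noncomputable section

namespace SpinChain

/-- Basis configurations of the sites in a finite set `A ⊂ ℤ`, each site carrying `ℂ^d` with its
standard basis. -/
abbrev Config (d : ℕ) (A : Finset ℤ) : Type := A → Fin d

/-- The algebra `𝓑^{⊗A}` of all linear operators on `(ℂ^d)^{⊗A}`, as matrices in the product
basis. -/
abbrev Op (d : ℕ) (A : Finset ℤ) : Type := Matrix (Config d A) (Config d A) ℂ

/-- `𝓑₀^{⊗A}` inside `𝓑^{⊗A}`: the operators whose partial trace over each single site of `A`
vanishes. For `A = ∅` this is all of `𝓑^{⊗∅} = ℂ`. -/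
def tracelessOp (d : ℕ) (A : Finset ℤ) : Submodule ℂ (Op d A) where
  carrier := {X | ∀ (a : A) (s t : Config d A),
    ∑ k : Fin d, X (Function.update s a k) (Function.update t a k) = 0}
  add_mem' := by
    intro X Y hX hY a s t
    simp only [Matrix.add_apply, Finset.sum_add_distrib]
    rw [hX a s t, hY a s t, add_zero]
  zero_mem' := by
    intro a s t
    simp
  smul_mem' := by
    intro c X hX a s t
    simp only [Matrix.smul_apply, ← Finset.smul_sum]
    rw [hX a s t, smul_zero]

/-- Formal operators `Φ = ∑_A Φ(A)` on the infinite chain: families `Φ(A) ∈ 𝓑₀^{⊗A}` indexed by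
the finite subsets `A ⊂ ℤ`, without any summability condition. -/
abbrev FormalOp (d : ℕ) : Type := (A : Finset ℤ) → tracelessOp d A

variable {d : ℕ}

/-! ### Adjoint, translation, range -/

/-- The adjoint `Φ† = ∑_A Φ(A)†`. -/
def adjoint (Φ : FormalOp d) : FormalOp d := fun A =>
  ⟨(Φ A : Op d A)ᴴ, by
    intro a s t
    have h := congrArg star ((Φ A).2 a t s)
    simpa [Matrix.conjTranspose_apply] using h⟩

/-- The translated set `A + x`. -/
def shiftSet (x : ℤ) (A : Finset ℤ) : Finset ℤ := A.map (Equiv.addRight x).toEmbedding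

/-- The bijection `a ↦ a + x` from `A` to `A + x`. -/
def shiftEquiv (x : ℤ) (A : Finset ℤ) : A ≃ shiftSet x A where
  toFun a := ⟨a + x, by simp [shiftSet]⟩
  invFun b := ⟨b - x, by
    obtain ⟨b, hb⟩ := b
    simp only [shiftSet, Finset.mem_map] at hb
    obtain ⟨c, hc, rfl⟩ := hb
    simpa using hc⟩
  left_inv a := by simp
  right_inv b := by simp

/-- The action on basis configurations of the unitary translation
`τ_A(x) : (ℂ^d)^{⊗A} → (ℂ^d)^{⊗(A+x)}`. -/
def shiftConfig (x : ℤ) (A : Finset ℤ) (s : Config d A) : Config d (shiftSet x A) :=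
  fun b => s ((shiftEquiv x A).symm b)

/-- The translation `𝒯(x)`, given by `𝒯(x)(Φ)(A) = τ_A(x)† Φ(A + x) τ_A(x)`. -/
def translate (x : ℤ) (Φ : FormalOp d) : FormalOp d := fun A =>
  ⟨(Φ (shiftSet x A) : Op d (shiftSet x A)).submatrix (shiftConfig x A) (shiftConfig x A), by
    intro a s t
    have key : ∀ (r : Config d A) (k : Fin d), shiftConfig x A (Function.update r a k)
        = Function.update (shiftConfig x A r) (shiftEquiv x A a) k := by
      intro r k
      funext b
      simp only [shiftConfig, Function.update_apply]
      congr 1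
      exact propext (Equiv.symm_apply_eq _)
    simp only [Matrix.submatrix_apply, key]
    exact (Φ (shiftSet x A)).2 _ _ _⟩

/-- `Φ` is translation invariant: `𝒯(Φ) = Φ` with `𝒯 = 𝒯(1)`. -/
def IsTranslationInvariant (Φ : FormalOp d) : Prop := translate 1 Φ = Φ

/-- `Φ` is Hermitian: `Φ† = Φ`. -/
def IsHermitian (Φ : FormalOp d) : Prop := adjoint Φ = Φ

/-- `Φ` is at most `r`-local: every `A` with `Φ(A) ≠ 0` lies in a block of at most `r` contiguous
sites, i.e. `A` is empty or `max A - min A + 1 ≤ r`. -/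
def IsAtMostLocal (r : ℕ) (Φ : FormalOp d) : Prop :=
  ∀ A : Finset ℤ, Φ A ≠ 0 → ∀ a ∈ A, ∀ b ∈ A, b - a + 1 ≤ (r : ℤ)

/-- `Φ` is local, i.e. of finite range: at most `r`-local for some finite `r`. -/
def IsLocal (Φ : FormalOp d) : Prop := ∃ r : ℕ, IsAtMostLocal r Φ

/-! ### Commutators -/

/-- Restriction of a configuration to a smaller set. -/
def resConfig {A B : Finset ℤ} (h : A ⊆ B) (s : Config d B) : Config d A :=
  fun a => s ⟨a, h a.2⟩

/-- The natural embedding `X ↦ X ⊗ I_{B \ A}` of `𝓑^{⊗A}` into `𝓑^{⊗B}` for `A ⊆ B`. -/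
def embed {A B : Finset ℤ} (h : A ⊆ B) (X : Op d A) : Op d B :=
  Matrix.of fun s t =>
    if ∀ b : B, (b : ℤ) ∉ A → s b = t b then X (resConfig h s) (resConfig h t) else 0

/-- The configuration on `B` equal to `s` on `C` and to `u` on `B \ C`. -/
def glue {C B : Finset ℤ} (s : Config d C) (u : {b : B // (b : ℤ) ∉ C} → Fin d) : Config d B :=
  fun b => if h : (b : ℤ) ∈ C then s ⟨b, h⟩ else u ⟨b, h⟩

/-- The normalized partial trace `d^{-|B \ C|} Tr_{B \ C} : 𝓑^{⊗B} → 𝓑^{⊗C}` for `C ⊆ B`. -/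
def partialTrace {C B : Finset ℤ} (_h : C ⊆ B) (Y : Op d B) : Op d C :=
  Matrix.of fun s t =>
    ((d : ℂ) ^ (B \ C).card)⁻¹ * ∑ u : {b : B // (b : ℤ) ∉ C} → Fin d, Y (glue s u) (glue t u)

/-- The projection `Y ↦ Y_A` from `𝓑^{⊗B} = ⨁_{A ⊆ B} 𝓑₀^{⊗A}` to the component `𝓑₀^{⊗A}`, by
inclusion-exclusion: `Y_A = ∑_{C ⊆ A} (-1)^{|A \ C|} d^{-|B \ C|} Tr_{B \ C}(Y) ⊗ I_{A \ C}`. -/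
def component {A B : Finset ℤ} (h : A ⊆ B) (Y : Op d B) : Op d A :=
  ∑ C ∈ A.powerset.attach, (-1 : ℂ) ^ (A \ C.1).card •
    embed (Finset.mem_powerset.1 C.2)
      (partialTrace ((Finset.mem_powerset.1 C.2).trans h) Y)

/-- The restriction `Φ|_B = ∑_{A ⊆ B} Φ(A) ∈ 𝓑^{⊗B}`. -/
def restrict (Φ : FormalOp d) (B : Finset ℤ) : Op d B :=
  ∑ A ∈ B.powerset.attach, embed (Finset.mem_powerset.1 A.2) (Φ A.1 : Op d A.1)

/-- `Z` is the value `[Φ, Ψ](A)`: it is `[Φ|_B, Ψ|_B]_A` for every sufficiently large finite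
`B ⊇ A`. -/
def IsCommValue (Φ Ψ : FormalOp d) (A : Finset ℤ) (Z : tracelessOp d A) : Prop :=
  ∃ B₀ : Finset ℤ, ∀ (B : Finset ℤ) (h : A ⊆ B), B₀ ⊆ B →
    component h (restrict Φ B * restrict Ψ B - restrict Ψ B * restrict Φ B) = (Z : Op d A)

open Classical in
/-- The commutator `[Φ, Ψ]`, with `[Φ, Ψ](A) = [Φ|_B, Ψ|_B]_A` for all sufficiently large finite
`B`. Such a value exists as soon as `Φ` is local, see `isCommValue_comm`; otherwise the default
value is `0`. -/
def comm (Φ Ψ : FormalOp d) : FormalOp d := fun A =>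
  if h : ∃ Z : tracelessOp d A, IsCommValue Φ Ψ A Z then h.choose else 0

/-! ### The commutator is well defined -/

theorem sum_update {ι : Type*} [Fintype ι] [DecidableEq ι] (a : ι) (f : (ι → Fin d) → ℂ) :
    ∑ u : ι → Fin d, ∑ k : Fin d, f (Function.update u a k) = d * ∑ u : ι → Fin d, f u := by
  have inv : Function.Involutive
      (fun p : (ι → Fin d) × Fin d => (Function.update p.1 a p.2, p.1 a)) := by
    rintro ⟨u, k⟩
    simp
  have e : ∑ p : (ι → Fin d) × Fin d, f (Function.update p.1 a p.2)
      = ∑ p : (ι → Fin d) × Fin d, f p.1 :=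
    Fintype.sum_equiv inv.toPerm _ (fun p => f p.1) (fun _ => rfl)
  rw [← Fintype.sum_prod_type' (fun u k => f (Function.update u a k)), e, Fintype.sum_prod_type]
  simp [Finset.mul_sum]

/-- Configurations on `B` are pairs of configurations on `C` and on `B \ C`. -/
def splitEquiv {C B : Finset ℤ} (h : C ⊆ B) :
    Config d C × ({b : B // (b : ℤ) ∉ C} → Fin d) ≃ Config d B where
  toFun p := glue p.1 p.2
  invFun w := (resConfig h w, fun b => w b.1)
  left_inv p := by
    ext1
    · funext a
      simp [resConfig, glue]
    · funext b
      simp [glue, b.2]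
  right_inv w := by
    funext b
    simp [resConfig, glue]

theorem sum_split {C B : Finset ℤ} (h : C ⊆ B) (f : Config d B → ℂ) :
    ∑ w, f w = ∑ s : Config d C, ∑ u : {b : B // (b : ℤ) ∉ C} → Fin d, f (glue s u) := by
  rw [← Fintype.sum_prod_type' (fun s u => f (glue s u))]
  exact (Fintype.sum_equiv (splitEquiv h) _ _ (fun _ => rfl)).symm

theorem resConfig_glue {C B : Finset ℤ} (h : C ⊆ B) (s : Config d C)
    (u : {b : B // (b : ℤ) ∉ C} → Fin d) : resConfig h (glue s u) = s := by
  funext a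
  simp [resConfig, glue]

theorem card_compl (C B : Finset ℤ) :
    Fintype.card {b : B // (b : ℤ) ∉ C} = (B \ C).card := by
  rw [← Fintype.card_coe]
  refine Fintype.card_congr ⟨fun b => ⟨b.1, by simp [b.2]⟩, fun b =>
    ⟨⟨b, (Finset.mem_sdiff.1 b.2).1⟩, (Finset.mem_sdiff.1 b.2).2⟩, ?_, ?_⟩
  · intro b; rfl
  · intro b; rfl

theorem embed_apply_glue {C B : Finset ℤ} (h : C ⊆ B) (X : Op d C) (s t : Config d C)
    (u v : {b : B // (b : ℤ) ∉ C} → Fin d) :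
    embed h X (glue s u) (glue t v) = if u = v then X s t else 0 := by
  simp only [embed, Matrix.of_apply, resConfig_glue]
  congr 1
  apply propext
  constructor
  · intro H
    funext b
    have := H b.1 b.2
    simpa [glue, b.2] using this
  · rintro rfl b hb
    simp [glue, hb]

theorem embed_add {A B : Finset ℤ} (h : A ⊆ B) (X Y : Op d A) :
    embed h (X + Y) = embed h X + embed h Y := by
  ext s t
  simp only [embed, Matrix.of_apply, Matrix.add_apply]
  split_ifs <;> simp

theorem embed_zero {A B : Finset ℤ} (h : A ⊆ B) : embed h (0 : Op d A) = 0 := by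
  ext s t
  simp [embed]

theorem embed_sum {A B : Finset ℤ} (h : A ⊆ B) {ι : Type*} (S : Finset ι) (f : ι → Op d A) :
    embed h (∑ i ∈ S, f i) = ∑ i ∈ S, embed h (f i) :=
  map_sum (⟨⟨embed h, embed_zero h⟩, embed_add h⟩ : Op d A →+ Op d B) f S

theorem embed_embed {A B C : Finset ℤ} (h : A ⊆ B) (h' : B ⊆ C) (X : Op d A) :
    embed h' (embed h X) = embed (h.trans h') X := by
  ext s t
  simp only [embed, Matrix.of_apply]
  rw [← ite_and]
  congr 1
  apply propext
  constructor
  · rintro ⟨h1, h2⟩ c hc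
    by_cases hb : (c : ℤ) ∈ B
    · exact h2 ⟨c, hb⟩ hc
    · exact h1 c hb
  · intro H
    exact ⟨fun c hc => H c (fun hA => hc (h hA)), fun b hb => H ⟨b, h' b.2⟩ hb⟩

theorem partialTrace_add {C B : Finset ℤ} (h : C ⊆ B) (X Y : Op d B) :
    partialTrace h (X + Y) = partialTrace h X + partialTrace h Y := by
  ext s t
  simp [partialTrace, Finset.sum_add_distrib, mul_add]

theorem partialTrace_sub {C B : Finset ℤ} (h : C ⊆ B) (X Y : Op d B) :
    partialTrace h (X - Y) = partialTrace h X - partialTrace h Y := by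
  ext s t
  simp [partialTrace, Finset.sum_sub_distrib, mul_sub]

theorem partialTrace_sum {C B : Finset ℤ} (h : C ⊆ B) {ι : Type*} (S : Finset ι)
    (f : ι → Op d B) : partialTrace h (∑ i ∈ S, f i) = ∑ i ∈ S, partialTrace h (f i) :=
  map_sum (⟨⟨partialTrace h, by ext s t; simp [partialTrace]⟩, partialTrace_add h⟩ :
    Op d B →+ Op d C) f S

theorem partialTrace_embed_mul {C B : Finset ℤ} (h : C ⊆ B) (X : Op d C) (Y : Op d B) :
    partialTrace h (embed h X * Y) = X * partialTrace h Y := by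
  ext s t
  simp only [partialTrace, Matrix.of_apply, Matrix.mul_apply]
  simp only [sum_split h, embed_apply_glue, ite_mul, zero_mul, Finset.sum_ite_eq,
    Finset.mem_univ, if_true]
  rw [Finset.sum_comm, Finset.mul_sum]
  refine Finset.sum_congr rfl fun w _ => ?_
  rw [← Finset.mul_sum]
  ring

theorem partialTrace_mul_embed {C B : Finset ℤ} (h : C ⊆ B) (X : Op d C) (Y : Op d B) :
    partialTrace h (Y * embed h X) = partialTrace h Y * X := by
  ext s t
  simp only [partialTrace, Matrix.of_apply, Matrix.mul_apply]
  simp only [sum_split h, embed_apply_glue, mul_ite, mul_zero, Finset.sum_ite_eq',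
    Finset.mem_univ, if_true]
  rw [Finset.sum_comm, Finset.mul_sum]
  refine Finset.sum_congr rfl fun w _ => ?_
  rw [← Finset.sum_mul]
  ring

theorem partialTrace_embed [NeZero d] {C B : Finset ℤ} (h : C ⊆ B) (X : Op d C) :
    partialTrace h (embed h X) = X := by
  ext s t
  have hd : (d : ℂ) ^ (B \ C).card ≠ 0 := pow_ne_zero _ (NeZero.ne _)
  simp only [partialTrace, Matrix.of_apply, embed_apply_glue, if_true, Finset.sum_const,
    Finset.card_univ, Fintype.card_fun, card_compl C B, Fintype.card_fin, nsmul_eq_mul,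
    Nat.cast_pow]
  rw [inv_mul_cancel_left₀ hd]

/-- The normalized partial trace as an average over all configurations of `B`. -/
theorem partialTrace_eq [NeZero d] {C B : Finset ℤ} (h : C ⊆ B) (Y : Op d B)
    (s t : Config d C) :
    partialTrace h Y s t = ((d : ℂ) ^ B.card)⁻¹ *
      ∑ w : Config d B, Y (glue s fun b => w b.1) (glue t fun b => w b.1) := by
  have hd : (d : ℂ) ≠ 0 := NeZero.ne _
  have hc : B.card = (B \ C).card + C.card := (Finset.card_sdiff_add_card_eq_card h).symm
  rw [sum_split h]
  have : ∀ (v : Config d C) (u : {b : B // (b : ℤ) ∉ C} → Fin d),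
      (fun b : {b : B // (b : ℤ) ∉ C} => (glue v u : Config d B) b.1) = u := by
    intro v u
    funext b
    simp [glue, b.2]
  simp only [this, Finset.sum_const, Finset.card_univ, Fintype.card_fun, Fintype.card_coe,
    Fintype.card_fin, nsmul_eq_mul, Nat.cast_pow, partialTrace, Matrix.of_apply]
  rw [hc, pow_add, mul_inv, mul_assoc, inv_mul_cancel_left₀ (pow_ne_zero _ hd)]

theorem partialTrace_partialTrace [NeZero d] {C D B : Finset ℤ} (h : C ⊆ D) (h' : D ⊆ B)
    (Y : Op d B) : partialTrace h (partialTrace h' Y) = partialTrace (h.trans h') Y := by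
  ext s t
  have hd : (d : ℂ) ≠ 0 := NeZero.ne _
  rw [partialTrace_eq, partialTrace_eq, sum_split h']
  simp only [partialTrace, Matrix.of_apply]
  rw [← Finset.mul_sum]
  have hc : B.card = (B \ D).card + D.card := (Finset.card_sdiff_add_card_eq_card h').symm
  rw [hc, pow_add, mul_inv]
  have : ∀ (r : Config d C) (v : Config d D) (u : {b : B // (b : ℤ) ∉ D} → Fin d),
      (glue (glue r fun b => v b.1 : Config d D) u : Config d B)
        = glue r fun b => (glue v u : Config d B) b.1 := by
    intro r v u
    funext b
    by_cases hC : (b : ℤ) ∈ C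
    · simp [glue, hC, h hC]
    · simp [glue, hC]
  simp only [this]
  ring

/-- Operators supported off `C` commute under the partial trace onto `C`. -/
theorem partialTrace_comm_of_disjoint {C D B : Finset ℤ} (hC : C ⊆ B) (hD : D ⊆ B)
    (hdisj : ∀ a ∈ D, a ∉ C) (X : Op d D) (Y : Op d B) :
    partialTrace hC (embed hD X * Y) = partialTrace hC (Y * embed hD X) := by
  ext s t
  have res : ∀ (r r' : Config d C) (u : {b : B // (b : ℤ) ∉ C} → Fin d),
      resConfig hD (glue r u) = resConfig hD (glue r' u) := by
    intro r r' u
    funext a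
    simp [resConfig, glue, hdisj a a.2]
  have e1 : ∀ (r r' : Config d C) (u v : {b : B // (b : ℤ) ∉ C} → Fin d), r ≠ r' →
      embed hD X (glue r u) (glue r' v) = 0 := by
    intro r r' u v hne
    simp only [embed, Matrix.of_apply]
    rw [if_neg]
    intro H
    apply hne
    funext c
    have := H ⟨c, hC c.2⟩ (fun hc => hdisj _ hc c.2)
    simpa [glue] using this
  have e2 : ∀ (r r' : Config d C) (u v : {b : B // (b : ℤ) ∉ C} → Fin d),
      embed hD X (glue r u) (glue r v) = embed hD X (glue r' u) (glue r' v) := by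
    intro r r' u v
    simp only [embed, Matrix.of_apply, res r r']
    congr 1
    apply propext
    refine forall_congr' fun b => forall_congr' fun _ => ?_
    by_cases hb : (b : ℤ) ∈ C <;> simp [glue, hb]
  simp only [partialTrace, Matrix.of_apply, Matrix.mul_apply]
  congr 1
  have l : ∀ u, ∑ w, embed hD X (glue s u) w * Y w (glue t u)
      = ∑ v, embed hD X (glue s u) (glue s v) * Y (glue s v) (glue t u) := by
    intro u
    rw [sum_split hC]
    refine Finset.sum_eq_single s (fun r _ hr => ?_) (by simp)
    simp [e1 s r _ _ hr.symm]
  have r : ∀ u, ∑ w, Y (glue s u) w * embed hD X w (glue t u)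
      = ∑ v, Y (glue s u) (glue t v) * embed hD X (glue t v) (glue t u) := by
    intro u
    rw [sum_split hC]
    refine Finset.sum_eq_single t (fun r _ hr => ?_) (by simp)
    simp [e1 r t _ _ hr]
  simp only [l, r]
  rw [Finset.sum_comm]
  refine Finset.sum_congr rfl fun u _ => Finset.sum_congr rfl fun v _ => ?_
  rw [e2 s t, mul_comm]

/-- An element of `𝓑₀^{⊗A}` has zero partial trace onto every set not containing `A`. -/
theorem partialTrace_embed_traceless [NeZero d] {A C B : Finset ℤ} (hA : A ⊆ B) (hC : C ⊆ B)
    (hAC : ¬ A ⊆ C) {X : Op d A} (hX : X ∈ tracelessOp d A) :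
    partialTrace hC (embed hA X) = 0 := by
  obtain ⟨a, haA, haC⟩ := Finset.not_subset.1 hAC
  have hd : (d : ℂ) ≠ 0 := NeZero.ne _
  ext s t
  simp only [partialTrace, Matrix.of_apply, Matrix.zero_apply]
  refine mul_eq_zero_of_right _ ?_
  have hsum := sum_update (d := d) (⟨⟨a, hA haA⟩, haC⟩ : {b : B // (b : ℤ) ∉ C})
    (fun u => embed hA X (glue s u) (glue t u))
  have hz : ∀ u : {b : B // (b : ℤ) ∉ C} → Fin d, ∑ k : Fin d,
      embed hA X (glue s (Function.update u ⟨⟨a, hA haA⟩, haC⟩ k))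
        (glue t (Function.update u ⟨⟨a, hA haA⟩, haC⟩ k)) = 0 := by
    intro u
    have res : ∀ (r : Config d C) (k : Fin d),
        resConfig hA (glue r (Function.update u ⟨⟨a, hA haA⟩, haC⟩ k))
          = Function.update (resConfig hA (glue r u)) ⟨a, haA⟩ k := by
      intro r k
      funext b
      by_cases hb : (b : ℤ) = a
      · have : b = ⟨a, haA⟩ := Subtype.ext hb
        subst this
        simp [resConfig, glue, haC]
      · have h1 : b ≠ ⟨a, haA⟩ := fun h => hb (congrArg Subtype.val h)
        by_cases hbC : (b : ℤ) ∈ C <;>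
          simp [resConfig, glue, hbC, h1, hb]
    have cond : ∀ k : Fin d, (∀ b : B, (b : ℤ) ∉ A →
        (glue s (Function.update u ⟨⟨a, hA haA⟩, haC⟩ k) : Config d B) b
          = (glue t (Function.update u ⟨⟨a, hA haA⟩, haC⟩ k) : Config d B) b) ↔
        (∀ b : B, (b : ℤ) ∉ A → (glue s u : Config d B) b = (glue t u : Config d B) b) := by
      intro k
      refine forall_congr' fun b => forall_congr' fun hb => ?_
      have hba : (b : ℤ) ≠ a := fun h => hb (h ▸ haA)
      have : b ≠ ⟨a, hA haA⟩ := fun h => hba (congrArg Subtype.val h)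
      by_cases hbC : (b : ℤ) ∈ C <;> simp [glue, hbC]
    simp only [embed, Matrix.of_apply, res, cond]
    split_ifs
    · exact hX ⟨a, haA⟩ _ _
    · simp
  rw [Finset.sum_eq_zero (fun u _ => hz u)] at hsum
  exact (mul_eq_zero.1 hsum.symm).resolve_left hd

theorem partialTrace_restrict [NeZero d] (Ψ : FormalOp d) {C B : Finset ℤ} (h : C ⊆ B) :
    partialTrace h (restrict Ψ B) = restrict Ψ C := by
  have e : ∀ A : B.powerset,
      partialTrace h (embed (Finset.mem_powerset.1 A.2) (Ψ A.1 : Op d A.1))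
        = if hA : A.1 ⊆ C then embed hA (Ψ A.1 : Op d A.1) else 0 := by
    intro A
    split_ifs with hA
    · rw [← embed_embed hA h, partialTrace_embed]
    · exact partialTrace_embed_traceless _ h hA (Ψ A.1).2
  rw [restrict, partialTrace_sum, Finset.sum_congr rfl fun A _ => e A]
  rw [Finset.sum_attach B.powerset
    (fun A => if hA : A ⊆ C then embed hA (Ψ A : Op d A) else 0)]
  rw [restrict, ← Finset.sum_subset (Finset.powerset_mono.2 h)]
  · rw [← Finset.sum_attach C.powerset]
    refine Finset.sum_congr rfl fun A _ => ?_
    rw [dif_pos (Finset.mem_powerset.1 A.2)]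
  · intro A _ hA
    rw [dif_neg (fun hc => hA (Finset.mem_powerset.2 hc))]

theorem restrict_split (Φ : FormalOp d) {C B : Finset ℤ} (h : C ⊆ B) :
    restrict Φ B = embed h (restrict Φ C) + ∑ A ∈ B.powerset.attach,
      if A.1 ⊆ C then 0 else embed (Finset.mem_powerset.1 A.2) (Φ A.1 : Op d A.1) := by
  have e : embed h (restrict Φ C) = ∑ A ∈ B.powerset.attach,
      if A.1 ⊆ C then embed (Finset.mem_powerset.1 A.2) (Φ A.1 : Op d A.1) else 0 := by
    have e1 : ∀ A : B.powerset,
        (if A.1 ⊆ C then embed (Finset.mem_powerset.1 A.2) (Φ A.1 : Op d A.1) else 0)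
        = if hA : A.1 ⊆ C then embed (hA.trans h) (Φ A.1 : Op d A.1) else 0 := by
      intro A
      split_ifs <;> rfl
    rw [Finset.sum_congr rfl fun A _ => e1 A, Finset.sum_attach B.powerset
      (fun A => if hA : A ⊆ C then embed (hA.trans h) (Φ A : Op d A) else 0),
      ← Finset.sum_subset (Finset.powerset_mono.2 h), restrict, embed_sum,
      ← Finset.sum_attach C.powerset]
    · refine Finset.sum_congr rfl fun A _ => ?_
      rw [dif_pos (Finset.mem_powerset.1 A.2), embed_embed]
    · intro A _ hA
      rw [dif_neg (fun hc => hA (Finset.mem_powerset.2 hc))]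
  rw [e, ← Finset.sum_add_distrib, restrict]
  refine Finset.sum_congr rfl fun A _ => ?_
  split_ifs <;> simp

/-- The component `Y_A` lies in `𝓑₀^{⊗A}`. -/
theorem component_mem [NeZero d] {A B : Finset ℤ} (h : A ⊆ B) (Y : Op d B) :
    component h Y ∈ tracelessOp d A := by
  intro a s t
  let ov : Finset ℤ → Config d A → Config d B → Config d B := fun C r w b =>
    if hb : (b : ℤ) ∈ C ∧ (b : ℤ) ∈ A then r ⟨b, hb.2⟩ else w b
  let T : Finset ℤ → Config d A → Config d A → ℂ := fun C s t =>
    if ∀ b : A, (b : ℤ) ∉ C → s b = t b then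
      ((d : ℂ) ^ B.card)⁻¹ * ∑ w : Config d B, Y (ov C s w) (ov C t w) else 0
  let S : Finset ℤ → ℂ := fun C =>
    ∑ k : Fin d, T C (Function.update s a k) (Function.update t a k)
  have hT : ∀ C : A.powerset, embed (Finset.mem_powerset.1 C.2)
      (partialTrace ((Finset.mem_powerset.1 C.2).trans h) Y) = Matrix.of (T C.1) := by
    rintro ⟨C, hC⟩
    have hC' := Finset.mem_powerset.1 hC
    ext s t
    simp only [embed, Matrix.of_apply, partialTrace_eq, T]
    have : ∀ (r : Config d A) (w : Config d B),
        (glue (resConfig hC' r) (fun b => w b.1) : Config d B) = ov C r w := by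
      intro r w
      funext b
      by_cases hb : (b : ℤ) ∈ C
      · simp [glue, ov, hb, hC' hb, resConfig]
      · simp [glue, ov, hb]
    simp only [this]
  have key : ∀ C : Finset ℤ, (a : ℤ) ∉ C → S (insert (a : ℤ) C) = S C := by
    intro C haC
    have c1 : ∀ k : Fin d, (∀ b : A, (b : ℤ) ∉ insert (a : ℤ) C →
        Function.update s a k b = Function.update t a k b) ↔
        (∀ b : A, (b : ℤ) ∉ C → Function.update s a k b = Function.update t a k b) := by
      intro k
      refine forall_congr' fun b => ?_
      by_cases hb : b = a
      · subst hb; simp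
      · simp [Subtype.coe_injective.eq_iff, hb]
    have c2 : ∀ k : Fin d, (∀ b : A, (b : ℤ) ∉ C →
        Function.update s a k b = Function.update t a k b) ↔
        (∀ b : A, (b : ℤ) ∉ C → b ≠ a → s b = t b) := by
      intro k
      refine forall_congr' fun b => forall_congr' fun _ => ?_
      by_cases hb : b = a
      · subst hb; simp
      · simp [hb]
    have o1 : ∀ (r : Config d A) (k : Fin d) (w : Config d B),
        ov (insert (a : ℤ) C) (Function.update r a k) w
          = ov C r (Function.update w ⟨a, h a.2⟩ k) := by
      intro r k w
      funext b
      by_cases hb : (b : ℤ) = a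
      · have : b = ⟨a, h a.2⟩ := Subtype.ext hb
        subst this
        simp [ov, haC]
      · have h1 : b ≠ ⟨a, h a.2⟩ := fun e => hb (congrArg Subtype.val e)
        by_cases hC : (b : ℤ) ∈ C
        · by_cases hA : (b : ℤ) ∈ A
          · have h2 : (⟨b, hA⟩ : A) ≠ a := fun e => hb (congrArg Subtype.val e)
            simp [ov, hC, hA, h2]
          · simp [ov, hA, h1]
        · simp [ov, hC, hb, h1]
    have o2 : ∀ (r : Config d A) (k : Fin d) (w : Config d B),
        ov C (Function.update r a k) w = ov C r w := by
      intro r k w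
      funext b
      by_cases hC : (b : ℤ) ∈ C
      · by_cases hA : (b : ℤ) ∈ A
        · have h2 : (⟨b, hA⟩ : A) ≠ a := by
            rintro rfl
            exact haC hC
          simp [ov, hC, hA, h2]
        · simp [ov, hA]
      · simp [ov, hC]
    simp only [S, T, c1, c2, o1, o2]
    split_ifs
    · rw [← Finset.mul_sum, Finset.sum_comm,
        sum_update (⟨a, h a.2⟩ : B) (fun w => Y (ov C s w) (ov C t w))]
      simp
      ring
    · rfl
  have goal : ∑ C ∈ A.powerset, (-1 : ℂ) ^ (A \ C).card * S C = 0 := by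
    have hA : insert (a : ℤ) (A.erase a) = A := Finset.insert_erase a.2
    rw [← hA, Finset.sum_powerset_insert (Finset.notMem_erase _ _), hA,
      ← Finset.sum_add_distrib]
    refine Finset.sum_eq_zero fun C hC => ?_
    have hC' := Finset.mem_powerset.1 hC
    have haC : (a : ℤ) ∉ C := fun e => Finset.notMem_erase _ _ (hC' e)
    rw [key C haC]
    have hcard : (A \ C).card = (A \ insert (a : ℤ) C).card + 1 := by
      have : A \ insert (a : ℤ) C = (A \ C).erase a := by
        ext x
        simp
        tauto
      rw [this, Finset.card_erase_add_one (by simp [haC])]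
    rw [hcard, pow_succ]
    ring
  rw [← goal, ← Finset.sum_attach A.powerset]
  simp only [component, hT, Matrix.sum_apply, Matrix.smul_apply, Matrix.of_apply, smul_eq_mul]
  rw [Finset.sum_comm]
  simp only [S, Finset.mul_sum]

/-- For local `Φ`, the value of `[Φ|_B, Ψ|_B]_A` does not depend on the choice of the
sufficiently large finite set `B`. -/
theorem exists_isCommValue [NeZero d] {Φ : FormalOp d} (hΦ : IsLocal Φ) (Ψ : FormalOp d)
    (A : Finset ℤ) : ∃ Z : tracelessOp d A, IsCommValue Φ Ψ A Z := by
  obtain ⟨r, hr⟩ := hΦ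
  let B₀ : Finset ℤ := A ∪ A.biUnion fun a => Finset.Icc (a - r) (a + r)
  have hA₀ : A ⊆ B₀ := Finset.subset_union_left
  have hfar : ∀ C : Finset ℤ, ¬ C ⊆ B₀ → Φ C ≠ 0 → ∀ c ∈ C, c ∉ A := by
    intro C hC hne c hc hcA
    apply hC
    intro x hx
    refine Finset.mem_union_right _ (Finset.mem_biUnion.2 ⟨c, hcA, Finset.mem_Icc.2 ?_⟩)
    have h1 := hr C hne c hc x hx
    have h2 := hr C hne x hx c hc
    omega
  refine ⟨⟨component hA₀
    (restrict Φ B₀ * restrict Ψ B₀ - restrict Ψ B₀ * restrict Φ B₀), component_mem _ _⟩,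
    B₀, fun B h hB => ?_⟩
  have main : ∀ (D : Finset ℤ) (hD : D ⊆ A),
      partialTrace (hD.trans h) (restrict Φ B * restrict Ψ B - restrict Ψ B * restrict Φ B)
      = partialTrace (hD.trans hA₀)
        (restrict Φ B₀ * restrict Ψ B₀ - restrict Ψ B₀ * restrict Φ B₀) := by
    intro D hD
    rw [restrict_split Φ hB]
    set R : Op d B := ∑ C ∈ B.powerset.attach,
      if C.1 ⊆ B₀ then 0 else embed (Finset.mem_powerset.1 C.2) (Φ C.1 : Op d C.1) with hR
    have hRc : partialTrace (hD.trans h) (R * restrict Ψ B)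
        = partialTrace (hD.trans h) (restrict Ψ B * R) := by
      rw [hR, Finset.sum_mul, Finset.mul_sum, partialTrace_sum, partialTrace_sum]
      refine Finset.sum_congr rfl fun C _ => ?_
      split_ifs with hC
      · simp
      · by_cases hne : Φ C.1 = 0
        · simp [hne, embed_zero]
        · exact partialTrace_comm_of_disjoint _ _
            (fun c hc hcD => hfar C.1 hC hne c hc (hD hcD)) _ _
    rw [add_mul, mul_add, partialTrace_sub, partialTrace_add, partialTrace_add, hRc,
      add_sub_add_right_eq_sub, ← partialTrace_sub,
      ← partialTrace_partialTrace (hD.trans hA₀) hB, partialTrace_sub hB,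
      partialTrace_embed_mul, partialTrace_mul_embed, partialTrace_restrict]
  simp only [component]
  refine Finset.sum_congr rfl fun D _ => ?_
  rw [main D.1 (Finset.mem_powerset.1 D.2)]

/-- For local `Φ`, the commutator `[Φ, Ψ]` is given by the defining formula. -/
theorem isCommValue_comm [NeZero d] {Φ : FormalOp d} (hΦ : IsLocal Φ) (Ψ : FormalOp d)
    (A : Finset ℤ) : IsCommValue Φ Ψ A (comm Φ Ψ A) := by
  have h := exists_isCommValue hΦ Ψ A
  have e : comm Φ Ψ A = h.choose := dif_pos h
  rw [e]
  exact h.choose_spec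

/-- The charges `Q⁽²⁾ = H` and `Q⁽ⁿ⁺¹⁾ = [B, Q⁽ⁿ⁾]`, for `n ≥ 2`. -/
def charge (B H : FormalOp d) (n : ℕ) : FormalOp d := (comm B)^[n - 2] H

theorem charge_two (B H : FormalOp d) : charge B H 2 = H := rfl

theorem charge_succ (B H : FormalOp d) {n : ℕ} (hn : 2 ≤ n) :
    charge B H (n + 1) = comm B (charge B H n) := by
  obtain ⟨k, rfl⟩ := Nat.exists_eq_add_of_le' hn
  exact Function.iterate_succ_apply' (comm B) k H

end SpinChain

end

namespace SpinChain

/-! The engine is semisimplicity. Let `H` be local, Hermitian and translation-invariant. On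
translation-invariant local operators, `[H, ·]` is symmetric for the inner product per site, in
which one argument is replaced by its density. If `[H, [H, Y]] = 0`, then `C = [H, Y]` has square
norm `⟨C, [H, Y]⟩`, which is conjugate to `⟨Y, [H, C]⟩ = 0`. So `C = 0`, because its remaining
scalar component, at `∅`, is the trace of a commutator. This is `comm_eq_zero_of_comm_comm_eq_zero`;
it is applied to `H` and also to `X`, which is Hermitian because `B` is.

The rest is Lie algebra. Translating `[H, [B, H]] = 0` and subtracting gives `[H, [X, H]] = 0`,
hence `[H, X] = 0`. If `Q` is invariant and commutes with `X`, then `[B, Q]` is invariant, and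
Jacobi with `[X, [B, X]] = 0` gives `[X, [X, [B, Q]]] = 0`, hence `[X, [B, Q]] = 0`. This yields
invariance of all charges (`charge_translationInvariant_and_comm`). Finally, induction on the sum of
the two indices, using `[B, ·]` to move an index from one charge to the other, reduces every
commutator of charges to one with `H`; there Jacobi and semisimplicity finish
(`comm_charge_charge`).

The infinite chain enters only through `restrict_comm`, which expresses a restricted commutator as
the partial trace of a matrix commutator in a large enough finite volume. Bilinearity, antisymmetry
and Jacobi are read off from there. -/

variable {d : ℕ}

attribute [local instance] LieRing.ofAssociativeRing

/-! ### Embeddings of matrix algebras -/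

theorem embed_self {A : Finset ℤ} (h : A ⊆ A) (X : Op d A) : embed h X = X := by
  ext s t
  simp only [embed, Matrix.of_apply]
  rw [if_pos fun b hb => absurd b.2 hb]
  rfl

theorem embed_sub {A B : Finset ℤ} (h : A ⊆ B) (X Y : Op d A) :
    embed h (X - Y) = embed h X - embed h Y :=
  map_sub (⟨⟨embed h, embed_zero h⟩, embed_add h⟩ : Op d A →+ Op d B) X Y

theorem embed_smul {A B : Finset ℤ} (h : A ⊆ B) (c : ℂ) (X : Op d A) :
    embed h (c • X) = c • embed h X := by
  ext s t
  simp only [embed, Matrix.of_apply, Matrix.smul_apply]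
  split_ifs <;> simp

theorem embed_mul {A B : Finset ℤ} (h : A ⊆ B) (X Y : Op d A) :
    embed h (X * Y) = embed h X * embed h Y := by
  ext s t
  obtain ⟨⟨s, u⟩, rfl⟩ := (splitEquiv h).surjective s
  obtain ⟨⟨t, v⟩, rfl⟩ := (splitEquiv h).surjective t
  change embed h (X * Y) (glue s u) (glue t v) = (embed h X * embed h Y) (glue s u) (glue t v)
  simp only [Matrix.mul_apply, sum_split h, embed_apply_glue]
  by_cases huv : u = v
  · subst huv
    simp
  · simp [huv]

theorem embed_lie {A B : Finset ℤ} (h : A ⊆ B) (X Y : Op d A) :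
    embed h ⁅X, Y⁆ = ⁅embed h X, embed h Y⁆ := by
  rw [Ring.lie_def, Ring.lie_def, embed_sub, embed_mul, embed_mul]

theorem embed_conjTranspose {A B : Finset ℤ} (h : A ⊆ B) (X : Op d A) :
    embed h Xᴴ = (embed h X)ᴴ := by
  ext s t
  simp only [embed, Matrix.of_apply, Matrix.conjTranspose_apply]
  have : (∀ b : B, (b : ℤ) ∉ A → s b = t b) ↔ ∀ b : B, (b : ℤ) ∉ A → t b = s b :=
    forall_congr' fun _ => forall_congr' fun _ => eq_comm
  simp only [this]
  split_ifs <;> simp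

/-- Operators on disjoint sets of sites commute. -/
theorem embed_lie_eq_zero_of_disjoint {A C B : Finset ℤ} (hA : A ⊆ B) (hC : C ⊆ B)
    (hd : Disjoint A C) (X : Op d A) (Y : Op d C) : ⁅embed hA X, embed hC Y⁆ = 0 := by
  have hdisj : ∀ a ∈ C, a ∉ A := fun a ha ha' => Finset.disjoint_left.1 hd ha' ha
  ext s t
  simp only [Ring.lie_def, Matrix.sub_apply, Matrix.zero_apply, Matrix.mul_apply]
  have key : ∀ (A C : Finset ℤ) (hA : A ⊆ B) (hC : C ⊆ B) (_ : ∀ a ∈ C, a ∉ A)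
      (X : Op d A) (Y : Op d C), ∑ w, embed hA X s w * embed hC Y w t =
      if ∀ b : B, (b : ℤ) ∉ A → (b : ℤ) ∉ C → s b = t b then
        X (resConfig hA s) (resConfig hA t) * Y (resConfig hC s) (resConfig hC t) else 0 := by
    intro A C hA hC hdisj X Y
    -- The only intermediate configuration that can contribute: the first factor forces `w = s` off
    -- `A`, the second forces `w = t` off `C`, hence on `A`. The resulting entry is symmetric in the
    -- two operators.
    let w₀ : Config d B := fun b => if (b : ℤ) ∈ A then t b else s b
    rw [Finset.sum_eq_single w₀]
    · have r1 : resConfig hA w₀ = resConfig hA t := by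
        funext a
        simp [resConfig, w₀]
      have r2 : resConfig hC w₀ = resConfig hC s := by
        funext a
        simp [resConfig, w₀, hdisj a a.2]
      simp only [embed, Matrix.of_apply, r1, r2]
      rw [if_pos (fun b hb => by simp [w₀, hb])]
      have : (∀ b : B, (b : ℤ) ∉ C → w₀ b = t b) ↔
          ∀ b : B, (b : ℤ) ∉ A → (b : ℤ) ∉ C → s b = t b := by
        refine forall_congr' fun b => ?_
        by_cases hb : (b : ℤ) ∈ A <;> simp [w₀, hb]
      simp only [this, mul_ite, mul_zero]
    · intro w _ hw
      by_cases h1 : ∀ b : B, (b : ℤ) ∉ A → s b = w b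
      · by_cases h2 : ∀ b : B, (b : ℤ) ∉ C → w b = t b
        · refine absurd (funext fun b => ?_) hw
          by_cases hb : (b : ℤ) ∈ A
          · simp only [w₀, if_pos hb]
            exact h2 b fun hc => hdisj _ hc hb
          · simp only [w₀, if_neg hb]
            exact (h1 b hb).symm
        · simp only [embed, Matrix.of_apply, if_neg h2, mul_zero]
      · simp only [embed, Matrix.of_apply, if_neg h1, zero_mul]
    · simp
  rw [key A C hA hC hdisj, key C A hC hA fun a ha ha' => hdisj a ha' ha, sub_eq_zero]
  have : (∀ b : B, (b : ℤ) ∉ A → (b : ℤ) ∉ C → s b = t b) ↔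
      ∀ b : B, (b : ℤ) ∉ C → (b : ℤ) ∉ A → s b = t b :=
    forall_congr' fun _ => forall_comm
  simp only [this, mul_comm]

/-! ### Restriction -/

theorem restrict_eq_sum (Φ : FormalOp d) (B : Finset ℤ) :
    restrict Φ B = ∑ A ∈ B.powerset, if h : A ⊆ B then embed h (Φ A : Op d A) else 0 := by
  rw [← Finset.sum_attach, restrict]
  exact Finset.sum_congr rfl fun A _ => by rw [dif_pos (Finset.mem_powerset.1 A.2)]

/-- The restriction to `A` is `Φ A` plus terms from proper subsets, so components are recovered by
induction on inclusion. Identities of formal operators thereby become matrix identities in finite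
volume. -/
theorem restrict_injective {Φ Ψ : FormalOp d} (h : ∀ B, restrict Φ B = restrict Ψ B) :
    Φ = Ψ := by
  funext A
  induction A using Finset.strongInduction with
  | H A ih =>
    have hA := h A
    rw [restrict_eq_sum, restrict_eq_sum, ← Finset.sum_erase_add _ _ (Finset.mem_powerset_self A),
      ← Finset.sum_erase_add A.powerset _ (Finset.mem_powerset_self A)] at hA
    rw [Finset.sum_congr rfl (g := fun C => if h : C ⊆ A then embed h (Ψ C : Op d C) else 0)
      (fun C hC => ?_)] at hA
    · have := add_left_cancel hA
      simp only [Finset.Subset.refl, dif_pos, embed_self] at this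
      exact Subtype.ext this
    · have hC' := Finset.mem_erase.1 hC
      rw [ih C (lt_of_le_of_ne (Finset.mem_powerset.1 hC'.2) hC'.1)]

/-- Restriction to `B` as an additive map. -/
noncomputable def restrictHom (B : Finset ℤ) : FormalOp d →+ Op d B where
  toFun Φ := restrict Φ B
  map_zero' := by simp [restrict, embed_zero]
  map_add' Φ Ψ := by simp [restrict, embed_add, Finset.sum_add_distrib]

theorem restrict_zero (B : Finset ℤ) : restrict (0 : FormalOp d) B = 0 :=
  map_zero (restrictHom B)

theorem restrict_add (Φ Ψ : FormalOp d) (B : Finset ℤ) :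
    restrict (Φ + Ψ) B = restrict Φ B + restrict Ψ B := map_add (restrictHom B) Φ Ψ

theorem restrict_sub (Φ Ψ : FormalOp d) (B : Finset ℤ) :
    restrict (Φ - Ψ) B = restrict Φ B - restrict Ψ B := map_sub (restrictHom B) Φ Ψ

theorem restrict_neg (Φ : FormalOp d) (B : Finset ℤ) :
    restrict (-Φ) B = -restrict Φ B := map_neg (restrictHom B) Φ

theorem restrict_sum {ι : Type*} (S : Finset ι) (f : ι → FormalOp d) (B : Finset ℤ) :
    restrict (∑ i ∈ S, f i) B = ∑ i ∈ S, restrict (f i) B := map_sum (restrictHom B) f S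

theorem partialTrace_zero {C B : Finset ℤ} (h : C ⊆ B) :
    partialTrace h (0 : Op d B) = 0 := by
  ext s t
  simp [partialTrace]

theorem partialTrace_neg {C B : Finset ℤ} (h : C ⊆ B) (Y : Op d B) :
    partialTrace h (-Y) = -partialTrace h Y := by
  ext s t
  simp [partialTrace]

theorem partialTrace_embed_lie {C B : Finset ℤ} (h : C ⊆ B) (X : Op d C) (Y : Op d B) :
    partialTrace h ⁅embed h X, Y⁆ = ⁅X, partialTrace h Y⁆ := by
  rw [Ring.lie_def, Ring.lie_def, partialTrace_sub, partialTrace_embed_mul,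
    partialTrace_mul_embed]

/-! ### Components -/

/-- Möbius inversion on the lattice of subsets. When a site `a` is added, the terms with `a ∈ C` and
`a ∉ D` cancel those with `a ∉ C`. -/
theorem sum_powerset_sum_powerset_neg_one_pow {M : Type*} [AddCommGroup M] [Module ℂ M]
    (A : Finset ℤ) (g : Finset ℤ → M) :
    ∑ C ∈ A.powerset, ∑ D ∈ C.powerset, (-1 : ℂ) ^ (C \ D).card • g D = g A := by
  induction A using Finset.induction_on generalizing g with
  | empty => simp
  | insert a A ha ih =>
    have key : ∀ C ∈ A.powerset, ∑ D ∈ (insert a C).powerset,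
        (-1 : ℂ) ^ (insert a C \ D).card • g D
        = ∑ D ∈ C.powerset, (-1 : ℂ) ^ (C \ D).card • g (insert a D)
          - ∑ D ∈ C.powerset, (-1 : ℂ) ^ (C \ D).card • g D := by
      intro C hC
      have haC : a ∉ C := fun h => ha (Finset.mem_powerset.1 hC h)
      rw [Finset.sum_powerset_insert haC, add_comm, sub_eq_add_neg, ← Finset.sum_neg_distrib]
      congr 1
      · refine Finset.sum_congr rfl fun D hD => ?_
        rw [Finset.insert_sdiff_insert, Finset.sdiff_insert_of_notMem haC]
      · refine Finset.sum_congr rfl fun D hD => ?_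
        have haD : a ∉ D := fun h => haC (Finset.mem_powerset.1 hD h)
        rw [Finset.insert_sdiff_of_notMem _ haD, Finset.card_insert_of_notMem (by simp [haC]),
          pow_succ]
        simp
    rw [Finset.sum_powerset_insert ha, Finset.sum_congr rfl key, Finset.sum_sub_distrib,
      add_sub_cancel, ih fun D => g (insert a D)]

theorem component_eq_sum {A B : Finset ℤ} (h : A ⊆ B) (Y : Op d B) :
    component h Y = ∑ C ∈ A.powerset, (-1 : ℂ) ^ (A \ C).card •
      if hC : C ⊆ A then embed hC (partialTrace (hC.trans h) Y) else 0 := by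
  rw [← Finset.sum_attach, component]
  exact Finset.sum_congr rfl fun C _ => by rw [dif_pos (Finset.mem_powerset.1 C.2)]

/-- The components of an operator add up to its partial trace. -/
theorem sum_embed_component {A B : Finset ℤ} (h : A ⊆ B) (Y : Op d B) :
    ∑ C ∈ A.powerset.attach, embed (Finset.mem_powerset.1 C.2)
      (component ((Finset.mem_powerset.1 C.2).trans h) Y) = partialTrace h Y := by
  have e : ∀ C : A.powerset, embed (Finset.mem_powerset.1 C.2)
      (component ((Finset.mem_powerset.1 C.2).trans h) Y)
      = ∑ D ∈ C.1.powerset, (-1 : ℂ) ^ (C.1 \ D).card •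
        if hD : D ⊆ A then embed hD (partialTrace (hD.trans h) Y) else 0 := by
    intro C
    have hC := Finset.mem_powerset.1 C.2
    rw [component_eq_sum, embed_sum]
    refine Finset.sum_congr rfl fun D hD => ?_
    have hD' := Finset.mem_powerset.1 hD
    rw [embed_smul, dif_pos hD', dif_pos (hD'.trans hC), embed_embed]
  rw [Finset.sum_congr rfl fun C _ => e C, Finset.sum_attach A.powerset
    (fun C => ∑ D ∈ C.powerset, (-1 : ℂ) ^ (C \ D).card •
        if hD : D ⊆ A then embed hD (partialTrace (hD.trans h) Y) else 0),
    sum_powerset_sum_powerset_neg_one_pow A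
      (fun D => if hD : D ⊆ A then embed hD (partialTrace (hD.trans h) Y) else 0),
    dif_pos (Finset.Subset.refl A), embed_self]

theorem component_partialTrace [NeZero d] {A C B : Finset ℤ} (h : A ⊆ C) (h' : C ⊆ B)
    (Y : Op d B) : component h (partialTrace h' Y) = component (h.trans h') Y := by
  simp only [component, partialTrace_partialTrace]

theorem component_zero {A B : Finset ℤ} (h : A ⊆ B) : component h (0 : Op d B) = 0 := by
  simp [component, partialTrace_zero, embed_zero]

theorem component_sum {A B : Finset ℤ} (h : A ⊆ B) {ι : Type*} (S : Finset ι)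
    (f : ι → Op d B) : component h (∑ i ∈ S, f i) = ∑ i ∈ S, component h (f i) := by
  simp only [component, partialTrace_sum, embed_sum, Finset.smul_sum]
  rw [Finset.sum_comm]

/-- The family of components of the restrictions of `Φ` has the same restrictions as `Φ`, by
`sum_embed_component`; injectivity of restriction identifies the two. -/
theorem component_restrict [NeZero d] (Φ : FormalOp d) {A B : Finset ℤ} (h : A ⊆ B) :
    component h (restrict Φ B) = Φ A := by
  let Ψ : FormalOp d := fun C =>
    ⟨component (Finset.Subset.refl C) (restrict Φ C), component_mem _ _⟩
  have hΨ : Ψ = Φ := by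
    refine restrict_injective fun C => ?_
    rw [← partialTrace_restrict Φ (Finset.Subset.refl C), ← sum_embed_component, restrict]
    refine Finset.sum_congr rfl fun D _ => ?_
    simp only [Ψ]
    rw [← partialTrace_restrict Φ (Finset.mem_powerset.1 D.2), component_partialTrace]
  rw [← component_partialTrace (Finset.Subset.refl A) h, partialTrace_restrict]
  exact congrArg Subtype.val (congrFun hΨ A)

/-- The formal operator whose components are those of an operator on the sites of `D`. -/
noncomputable def ofOp [NeZero d] {D : Finset ℤ} (Z : Op d D) : FormalOp d := fun A =>
  if h : A ⊆ D then ⟨component h Z, component_mem h Z⟩ else 0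

theorem restrict_ofOp [NeZero d] {D B : Finset ℤ} (h : D ⊆ B) (Z : Op d D) :
    restrict (ofOp Z) B = embed h Z := by
  have e : restrict (ofOp Z) D = Z := by
    have := sum_embed_component (Finset.Subset.refl D) Z
    rw [← embed_self (Finset.Subset.refl D) Z, partialTrace_embed, embed_self] at this
    conv_rhs => rw [← this]
    refine Finset.sum_congr rfl fun C _ => ?_
    rw [ofOp, dif_pos (Finset.mem_powerset.1 C.2)]
  rw [restrict_split _ h, e, add_eq_left]
  refine Finset.sum_eq_zero fun A _ => ?_
  split_ifs with hA
  · rfl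
  · simp [ofOp, hA, embed_zero]

/-- An embedded operator is the restriction of `ofOp Z`, which has no component outside `D`. -/
theorem component_embed_eq_zero [NeZero d] {A D B : Finset ℤ} (hA : A ⊆ B) (hD : D ⊆ B)
    (hAD : ¬ A ⊆ D) (Z : Op d D) : component hA (embed hD Z) = 0 := by
  rw [← restrict_ofOp hD, component_restrict]
  simp [ofOp, hAD]

/-! ### Commutators through restrictions -/

/-- The sites at distance at most `r` from `A`. -/
noncomputable def nbhd (r : ℕ) (A : Finset ℤ) : Finset ℤ :=
  A.biUnion fun a => Finset.Icc (a - r) (a + r)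

theorem subset_nbhd (r : ℕ) (A : Finset ℤ) : A ⊆ nbhd r A := fun a ha =>
  Finset.mem_biUnion.2 ⟨a, ha, Finset.mem_Icc.2 ⟨by omega, by omega⟩⟩

/-- A term of an `r`-local formal operator that is not contained in `nbhd r A` is disjoint
from `A`. -/
theorem IsAtMostLocal.disjoint {r : ℕ} {Φ : FormalOp d} (hΦ : IsAtMostLocal r Φ)
    {A B C : Finset ℤ} (hN : nbhd r A ⊆ B) (hC : ¬ C ⊆ B) (hne : Φ C ≠ 0) : Disjoint C A := by
  refine Finset.disjoint_left.2 fun c hc hcA => hC fun x hx => hN ?_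
  refine Finset.mem_biUnion.2 ⟨c, hcA, Finset.mem_Icc.2 ?_⟩
  have h1 := hΦ C hne c hc x hx
  have h2 := hΦ C hne x hx c hc
  omega

theorem IsAtMostLocal.mono {r s : ℕ} {Φ : FormalOp d} (hΦ : IsAtMostLocal r Φ) (h : r ≤ s) :
    IsAtMostLocal s Φ := fun A hA a ha b hb => (hΦ A hA a ha b hb).trans (by exact_mod_cast h)

/-- A term of `Φ` not contained in `B` is disjoint from `A`, so its commutator with anything has
zero partial trace onto `A`. -/
theorem partialTrace_restrict_lie {r : ℕ} {Φ : FormalOp d} (hΦ : IsAtMostLocal r Φ)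
    {A B M : Finset ℤ} (hA : A ⊆ M) (hN : nbhd r A ⊆ B) (hM : B ⊆ M) (Y : Op d M) :
    partialTrace hA ⁅restrict Φ M, Y⁆ = partialTrace hA ⁅embed hM (restrict Φ B), Y⁆ := by
  rw [restrict_split Φ hM, add_lie, partialTrace_add, add_eq_left, sum_lie,
    partialTrace_sum]
  refine Finset.sum_eq_zero fun C _ => ?_
  split_ifs with hC
  · rw [zero_lie, partialTrace_zero]
  · by_cases hne : Φ C.1 = 0
    · simp [hne, embed_zero, partialTrace_zero]
    · rw [Ring.lie_def, partialTrace_sub, sub_eq_zero]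
      exact partialTrace_comm_of_disjoint _ _
        (fun a ha => Finset.disjoint_left.1 (hΦ.disjoint hN hC hne) ha) _ _

/-- Replaces the choice in `comm` by an explicit formula, valid in any volume containing the
`r`-neighbourhood of `A`. Only the first argument needs finite range. -/
theorem restrict_comm [NeZero d] {r : ℕ} {Φ : FormalOp d} (hΦ : IsAtMostLocal r Φ)
    (Ψ : FormalOp d) {A B : Finset ℤ} (hA : A ⊆ B) (hN : nbhd r A ⊆ B) :
    restrict (comm Φ Ψ) A = partialTrace hA ⁅restrict Φ B, restrict Ψ B⁆ := by
  have hv : ∀ C : Finset ℤ, ∃ B₀ : Finset ℤ, ∀ (B : Finset ℤ) (h : C ⊆ B), B₀ ⊆ B →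
      component h (restrict Φ B * restrict Ψ B - restrict Ψ B * restrict Φ B)
        = (comm Φ Ψ C : Op d C) := fun C => isCommValue_comm ⟨r, hΦ⟩ Ψ C
  choose B₀ hB₀ using hv
  -- Large enough for the defining formula at every `C ⊆ A` simultaneously; afterwards the volume is
  -- cut back to `B`.
  let M := B ∪ A.powerset.biUnion B₀
  have hM : B ⊆ M := Finset.subset_union_left
  have e : restrict (comm Φ Ψ) A
      = partialTrace (hA.trans hM) ⁅restrict Φ M, restrict Ψ M⁆ := by
    rw [← sum_embed_component, restrict]
    refine Finset.sum_congr rfl fun C _ => ?_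
    rw [Ring.lie_def, hB₀]
    exact (Finset.subset_biUnion_of_mem B₀ C.2).trans Finset.subset_union_right
  rw [e, partialTrace_restrict_lie hΦ _ hN hM, ← partialTrace_partialTrace hA hM,
    partialTrace_embed_lie, partialTrace_restrict]

theorem restrict_comm_comm [NeZero d] {r s : ℕ} {Φ Ψ : FormalOp d} (hΦ : IsAtMostLocal r Φ)
    (hΨ : IsAtMostLocal s Ψ) (Ω : FormalOp d) {A B : Finset ℤ} (hA : A ⊆ B)
    (hN : nbhd s (nbhd r A) ⊆ B) : restrict (comm Φ (comm Ψ Ω)) A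
      = partialTrace hA ⁅restrict Φ B, ⁅restrict Ψ B, restrict Ω B⁆⁆ := by
  have hC : nbhd r A ⊆ B := (subset_nbhd _ _).trans hN
  rw [restrict_comm hΦ _ (subset_nbhd r A) Finset.Subset.rfl, restrict_comm hΨ Ω hC hN,
    ← partialTrace_embed_lie, partialTrace_partialTrace,
    partialTrace_restrict_lie hΦ hA Finset.Subset.rfl hC]

/-! ### The Lie algebra of local formal operators -/

theorem isAtMostLocal_add {r : ℕ} {Φ Ψ : FormalOp d} (hΦ : IsAtMostLocal r Φ)
    (hΨ : IsAtMostLocal r Ψ) : IsAtMostLocal r (Φ + Ψ) := by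
  intro A hA
  by_cases h : Φ A = 0
  · exact hΨ A fun h' => hA (by simp [h, h'])
  · exact hΦ A h

theorem isAtMostLocal_neg {r : ℕ} {Φ : FormalOp d} (hΦ : IsAtMostLocal r Φ) :
    IsAtMostLocal r (-Φ) := fun A hA => hΦ A fun h => hA (by simp [h])

theorem isLocal_zero : IsLocal (0 : FormalOp d) := ⟨0, fun _ hA => absurd rfl hA⟩

theorem isLocal_add {Φ Ψ : FormalOp d} (hΦ : IsLocal Φ) (hΨ : IsLocal Ψ) :
    IsLocal (Φ + Ψ) := by
  obtain ⟨r, hr⟩ := hΦ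
  obtain ⟨s, hs⟩ := hΨ
  exact ⟨max r s, isAtMostLocal_add (hr.mono (le_max_left _ _)) (hs.mono (le_max_right _ _))⟩

theorem isLocal_neg {Φ : FormalOp d} (hΦ : IsLocal Φ) : IsLocal (-Φ) :=
  hΦ.imp fun _ => isAtMostLocal_neg

theorem isLocal_sub {Φ Ψ : FormalOp d} (hΦ : IsLocal Φ) (hΨ : IsLocal Ψ) :
    IsLocal (Φ - Ψ) := sub_eq_add_neg Φ Ψ ▸ isLocal_add hΦ (isLocal_neg hΨ)

theorem component_lie_eq_zero [NeZero d] {A B C D : Finset ℤ} (hA : A ⊆ B) (hC : C ⊆ B)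
    (hD : D ⊆ B) (h : Disjoint C D ∨ ¬ A ⊆ C ∪ D) (X : Op d C) (Y : Op d D) :
    component hA ⁅embed hC X, embed hD Y⁆ = 0 := by
  rcases h with h | h
  · rw [embed_lie_eq_zero_of_disjoint hC hD h, component_zero]
  · rw [← embed_embed Finset.subset_union_left (Finset.union_subset hC hD) X,
      ← embed_embed Finset.subset_union_right (Finset.union_subset hC hD) Y, ← embed_lie,
      component_embed_eq_zero hA _ h]

/-- The terms `Φ C` and `Ψ D` contribute at `A` only if `C` meets `D` and `A ⊆ C ∪ D`, so the ranges
add. -/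
theorem isLocal_comm [NeZero d] {Φ Ψ : FormalOp d} (hΦ : IsLocal Φ) (hΨ : IsLocal Ψ) :
    IsLocal (comm Φ Ψ) := by
  obtain ⟨r, hr⟩ := hΦ
  obtain ⟨s, hs⟩ := hΨ
  refine ⟨r + s, fun A hne a ha b hb => ?_⟩
  by_contra hab
  apply hne
  obtain ⟨B₀, hB₀⟩ := isCommValue_comm ⟨r, hr⟩ Ψ A
  have hA : A ⊆ A ∪ B₀ := Finset.subset_union_left
  apply Subtype.ext
  rw [← hB₀ _ hA Finset.subset_union_right, ← Ring.lie_def, restrict, restrict,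
    sum_lie, component_sum]
  refine Finset.sum_eq_zero fun C _ => ?_
  rw [lie_sum, component_sum]
  refine Finset.sum_eq_zero fun D _ => ?_
  by_cases hC : Φ C.1 = 0
  · simp [hC, embed_zero, component_zero]
  by_cases hD : Ψ D.1 = 0
  · simp [hD, embed_zero, component_zero]
  refine component_lie_eq_zero _ _ _ ?_ _ _
  by_contra! h
  obtain ⟨x, hxC, hxD⟩ := Finset.not_disjoint_iff.1 h.1
  have bound : ∀ y ∈ A, ∀ z ∈ A, z - y + 1 ≤ ((r + s : ℕ) : ℤ) := by
    intro y hy z hz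
    push_cast
    have h1 := hr C.1 hC x hxC x hxC
    have h2 := hs D.1 hD x hxD x hxD
    rcases Finset.mem_union.1 (h.2 hy) with hy | hy <;>
      rcases Finset.mem_union.1 (h.2 hz) with hz | hz
    · have := hr C.1 hC y hy z hz
      omega
    · have := hr C.1 hC y hy x hxC
      have := hs D.1 hD x hxD z hz
      omega
    · have := hs D.1 hD y hy x hxD
      have := hr C.1 hC x hxC z hz
      omega
    · have := hs D.1 hD y hy z hz
      omega
  exact hab (bound a ha b hb)

theorem comm_add [NeZero d] {Φ : FormalOp d} (hΦ : IsLocal Φ) (Ψ Ω : FormalOp d) :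
    comm Φ (Ψ + Ω) = comm Φ Ψ + comm Φ Ω := by
  obtain ⟨r, hr⟩ := hΦ
  refine restrict_injective fun A => ?_
  simp only [restrict_add, restrict_comm hr _ (subset_nbhd r A) Finset.Subset.rfl, lie_add,
    partialTrace_add]

theorem comm_zero [NeZero d] {Φ : FormalOp d} (hΦ : IsLocal Φ) : comm Φ 0 = 0 := by
  simpa using comm_add hΦ 0 0

theorem zero_comm [NeZero d] (Ψ : FormalOp d) : comm 0 Ψ = 0 := by
  obtain ⟨r, hr⟩ := isLocal_zero (d := d)
  refine restrict_injective fun A => ?_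
  rw [restrict_comm hr _ (subset_nbhd r A) Finset.Subset.rfl, restrict_zero, zero_lie,
    partialTrace_zero, restrict_zero]

theorem comm_neg [NeZero d] {Φ : FormalOp d} (hΦ : IsLocal Φ) (Ψ : FormalOp d) :
    comm Φ (-Ψ) = -comm Φ Ψ := by
  rw [eq_neg_iff_add_eq_zero, ← comm_add hΦ, neg_add_cancel, comm_zero hΦ]

theorem comm_swap [NeZero d] {Φ Ψ : FormalOp d} (hΦ : IsLocal Φ) (hΨ : IsLocal Ψ) :
    comm Φ Ψ = -comm Ψ Φ := by
  obtain ⟨r, hr⟩ := hΦ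
  obtain ⟨s, hs⟩ := hΨ
  refine restrict_injective fun A => ?_
  have h : A ⊆ nbhd r A ∪ nbhd s A := (subset_nbhd r A).trans Finset.subset_union_left
  rw [restrict_neg, restrict_comm hr _ h Finset.subset_union_left,
    restrict_comm hs _ h Finset.subset_union_right, ← lie_skew,
    partialTrace_neg]

theorem comm_self [NeZero d] {Φ : FormalOp d} (hΦ : IsLocal Φ) : comm Φ Φ = 0 := by
  obtain ⟨r, hr⟩ := hΦ
  refine restrict_injective fun A => ?_
  rw [restrict_comm hr _ (subset_nbhd r A) Finset.Subset.rfl, lie_self, partialTrace_zero,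
    restrict_zero]

theorem add_comm_left [NeZero d] {Φ Ψ Ω : FormalOp d} (hΦ : IsLocal Φ) (hΨ : IsLocal Ψ)
    (hΩ : IsLocal Ω) : comm (Φ + Ψ) Ω = comm Φ Ω + comm Ψ Ω := by
  rw [comm_swap (isLocal_add hΦ hΨ) hΩ, comm_add hΩ, comm_swap hΦ hΩ, comm_swap hΨ hΩ, neg_add]

theorem comm_jacobi [NeZero d] {Φ Ψ Ω : FormalOp d} (hΦ : IsLocal Φ) (hΨ : IsLocal Ψ)
    (hΩ : IsLocal Ω) :
    comm Φ (comm Ψ Ω) = comm (comm Φ Ψ) Ω + comm Ψ (comm Φ Ω) := by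
  -- With every double commutator nested to the right, `restrict_comm_comm` applies to all three in
  -- the common volume `M`, and Jacobi is the Leibniz rule for matrices.
  rw [comm_swap (isLocal_comm hΦ hΨ) hΩ]
  obtain ⟨r, hr⟩ := hΦ
  obtain ⟨s, hs⟩ := hΨ
  obtain ⟨t, ht⟩ := hΩ
  refine restrict_injective fun A => ?_
  let M := nbhd s (nbhd r A) ∪ (nbhd r (nbhd t A) ∪ nbhd r (nbhd s A))
  have h : A ⊆ M := ((subset_nbhd r A).trans (subset_nbhd s _)).trans Finset.subset_union_left
  rw [restrict_add, restrict_neg, restrict_comm_comm hr hs Ω h Finset.subset_union_left,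
    restrict_comm_comm ht hr Ψ h (Finset.subset_union_left.trans Finset.subset_union_right),
    restrict_comm_comm hs hr Ω h (Finset.subset_union_right.trans Finset.subset_union_right),
    leibniz_lie, partialTrace_add, ← lie_skew (restrict Ω M), partialTrace_neg, neg_neg]

/-! ### Translations -/

theorem mem_shiftSet {x a : ℤ} {A : Finset ℤ} : a ∈ shiftSet x A ↔ a - x ∈ A := by
  simp only [shiftSet, Finset.mem_map_equiv]
  rfl

theorem shiftSet_subset {x : ℤ} {A B : Finset ℤ} (h : A ⊆ B) : shiftSet x A ⊆ shiftSet x B :=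
  Finset.map_subset_map.2 h

theorem shiftSet_shiftSet (x y : ℤ) (A : Finset ℤ) :
    shiftSet y (shiftSet x A) = shiftSet (x + y) A := by
  ext a
  simp only [mem_shiftSet]
  rw [sub_sub, add_comm]

theorem shiftSet_zero (A : Finset ℤ) : shiftSet 0 A = A := by
  ext a
  simp [mem_shiftSet]

theorem card_shiftSet (x : ℤ) (A : Finset ℤ) : (shiftSet x A).card = A.card :=
  Finset.card_map _

/-- The translation of basis configurations as a bijection. -/
def shiftConfigEquiv (x : ℤ) (A : Finset ℤ) : Config d A ≃ Config d (shiftSet x A) :=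
  (shiftEquiv x A).arrowCongr (Equiv.refl (Fin d))

/-- The operator `τ_A(x)† Y τ_A(x)`. -/
def pull (x : ℤ) {A : Finset ℤ} (Y : Op d (shiftSet x A)) : Op d A :=
  Y.submatrix (shiftConfigEquiv x A) (shiftConfigEquiv x A)

theorem pull_sum (x : ℤ) {A : Finset ℤ} {ι : Type*} (S : Finset ι)
    (f : ι → Op d (shiftSet x A)) : pull x (∑ i ∈ S, f i) = ∑ i ∈ S, pull x (f i) := by
  ext s t
  simp [pull, Matrix.sum_apply]

theorem pull_mul (x : ℤ) {A : Finset ℤ} (Y Z : Op d (shiftSet x A)) :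
    pull x (Y * Z) = pull x Y * pull x Z :=
  (Matrix.submatrix_mul_equiv Y Z _ _ _).symm

theorem pull_lie (x : ℤ) {A : Finset ℤ} (Y Z : Op d (shiftSet x A)) :
    pull x ⁅Y, Z⁆ = ⁅pull x Y, pull x Z⁆ := by
  rw [Ring.lie_def, Ring.lie_def, ← pull_mul, ← pull_mul]
  rfl

theorem pull_conjTranspose (x : ℤ) {A : Finset ℤ} (Y : Op d (shiftSet x A)) :
    pull x Yᴴ = (pull x Y)ᴴ := rfl

theorem pull_embed (x : ℤ) {A B : Finset ℤ} (h : A ⊆ B) (X : Op d (shiftSet x A)) :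
    pull x (embed (shiftSet_subset h) X) = embed h (pull x X) := by
  ext s t
  simp only [pull, embed, Matrix.of_apply, Matrix.submatrix_apply]
  have : (∀ b : shiftSet x B, (b : ℤ) ∉ shiftSet x A →
      shiftConfigEquiv x B s b = shiftConfigEquiv x B t b) ↔
      ∀ b : B, (b : ℤ) ∉ A → s b = t b := by
    rw [← (shiftEquiv x B).forall_congr_right]
    refine forall_congr' fun b => ?_
    have e : ((shiftEquiv x B b : ℤ) ∈ shiftSet x A) ↔ (b : ℤ) ∈ A := by
      rw [mem_shiftSet]
      simp [shiftEquiv]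
    simp [e, shiftConfigEquiv]
  simp only [this]
  rfl

theorem translate_apply (x : ℤ) (Φ : FormalOp d) (A : Finset ℤ) :
    (translate x Φ A : Op d A) = pull x (Φ (shiftSet x A) : Op d (shiftSet x A)) := rfl

theorem translate_apply_eq_zero_iff {x : ℤ} {Φ : FormalOp d} {A : Finset ℤ} :
    translate x Φ A = 0 ↔ Φ (shiftSet x A) = 0 := by
  rw [← Subtype.coe_inj, ← Subtype.coe_inj, translate_apply]
  constructor
  · intro h
    ext s t
    have := congrFun (congrFun h ((shiftConfigEquiv x A).symm s)) ((shiftConfigEquiv x A).symm t)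
    simpa [pull] using this
  · intro h
    rw [h]
    rfl

theorem restrict_translate (x : ℤ) (Φ : FormalOp d) (B : Finset ℤ) :
    restrict (translate x Φ) B = pull x (restrict Φ (shiftSet x B)) := by
  rw [restrict_eq_sum, restrict_eq_sum, pull_sum]
  refine Finset.sum_nbij' (shiftSet x) (shiftSet (-x)) ?_ ?_ ?_ ?_ ?_
  · intro A hA
    exact Finset.mem_powerset.2 (shiftSet_subset (Finset.mem_powerset.1 hA))
  · intro A hA
    have := shiftSet_subset (x := -x) (Finset.mem_powerset.1 hA)
    rwa [shiftSet_shiftSet, add_neg_cancel, shiftSet_zero, ← Finset.mem_powerset] at this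
  · intro A _
    rw [shiftSet_shiftSet, add_neg_cancel, shiftSet_zero]
  · intro A _
    rw [shiftSet_shiftSet, neg_add_cancel, shiftSet_zero]
  · intro A hA
    have hA' := Finset.mem_powerset.1 hA
    rw [dif_pos hA', dif_pos (shiftSet_subset hA'), pull_embed, translate_apply]

/-- `Y` is a restriction of `ofOp Y`, and for restrictions partial trace is again restriction, which
is compatible with translation. -/
theorem pull_partialTrace [NeZero d] (x : ℤ) {A B : Finset ℤ} (h : A ⊆ B)
    (Y : Op d (shiftSet x B)) :
    pull x (partialTrace (shiftSet_subset h) Y) = partialTrace h (pull x Y) := by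
  rw [← embed_self Finset.Subset.rfl Y, ← restrict_ofOp Finset.Subset.rfl,
    partialTrace_restrict, ← restrict_translate, ← restrict_translate, partialTrace_restrict]

theorem translate_isAtMostLocal {r : ℕ} {Φ : FormalOp d} (hΦ : IsAtMostLocal r Φ) (x : ℤ) :
    IsAtMostLocal r (translate x Φ) := by
  intro A hA a ha b hb
  have := hΦ (shiftSet x A) (fun h => hA (translate_apply_eq_zero_iff.2 h)) (a + x)
    (by simpa [mem_shiftSet] using ha) (b + x) (by simpa [mem_shiftSet] using hb)
  omega

theorem translate_isLocal {Φ : FormalOp d} (hΦ : IsLocal Φ) (x : ℤ) :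
    IsLocal (translate x Φ) := hΦ.imp fun _ h => translate_isAtMostLocal h x

theorem translate_comm [NeZero d] {Φ : FormalOp d} (hΦ : IsLocal Φ) (Ψ : FormalOp d) (x : ℤ) :
    translate x (comm Φ Ψ) = comm (translate x Φ) (translate x Ψ) := by
  obtain ⟨r, hr⟩ := hΦ
  refine restrict_injective fun A => ?_
  have hN : nbhd r (shiftSet x A) ⊆ shiftSet x (nbhd r A) := by
    intro b hb
    obtain ⟨a, ha, hab⟩ := Finset.mem_biUnion.1 hb
    rw [mem_shiftSet] at ha ⊢
    rw [Finset.mem_Icc] at hab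
    exact Finset.mem_biUnion.2 ⟨a - x, ha, Finset.mem_Icc.2 ⟨by omega, by omega⟩⟩
  rw [restrict_translate, restrict_comm hr Ψ (shiftSet_subset (subset_nbhd r A)) hN,
    restrict_comm (translate_isAtMostLocal hr x) _ (subset_nbhd r A) Finset.Subset.rfl,
    pull_partialTrace, pull_lie, restrict_translate, restrict_translate]

theorem translate_zero_right (x : ℤ) : translate x (0 : FormalOp d) = 0 := rfl

/-- Iterated shifts of a set agree with a single shift only propositionally; this transports matrix
entries between the two types. -/
theorem apply_congr (Φ : FormalOp d) {A A' : Finset ℤ} (h : A = A') (s t : Config d A) :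
    (Φ A : Op d A) s t = (Φ A' : Op d A') (fun a => s ⟨a, h ▸ a.2⟩) fun a => t ⟨a, h ▸ a.2⟩ := by
  subst h
  rfl

theorem translate_translate (x y : ℤ) (Φ : FormalOp d) :
    translate x (translate y Φ) = translate (x + y) Φ := by
  funext A
  ext s t
  simp only [translate, Matrix.submatrix_apply]
  rw [apply_congr Φ (shiftSet_shiftSet x y A)]
  refine congrArg₂ _ (funext fun a => congrArg s (Subtype.ext ?_))
    (funext fun a => congrArg t (Subtype.ext ?_)) <;> simp [shiftEquiv] <;> ring

theorem translate_zero (Φ : FormalOp d) : translate 0 Φ = Φ := by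
  funext A
  ext s t
  simp only [translate, Matrix.submatrix_apply]
  rw [apply_congr Φ (shiftSet_zero A)]
  refine congrArg₂ _ (funext fun a => congrArg s (Subtype.ext ?_))
    (funext fun a => congrArg t (Subtype.ext ?_)) <;> simp [shiftEquiv]

theorem IsTranslationInvariant.translate_eq {Φ : FormalOp d} (h : IsTranslationInvariant Φ)
    (x : ℤ) : translate x Φ = Φ := by
  induction x using Int.induction_on with
  | zero => exact translate_zero Φ
  | succ n ih =>
    rw [← translate_translate, show translate 1 Φ = Φ from h, ih]
  | pred n ih =>
    conv_lhs => rw [← show translate 1 Φ = Φ from h, translate_translate]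
    rwa [sub_add_cancel]

theorem adjoint_translate (x : ℤ) (Φ : FormalOp d) :
    adjoint (translate x Φ) = translate x (adjoint Φ) := rfl

theorem adjoint_sub (Φ Ψ : FormalOp d) : adjoint (Φ - Ψ) = adjoint Φ - adjoint Ψ := by
  funext A
  exact Subtype.ext (Matrix.conjTranspose_sub _ _)

theorem restrict_adjoint (Φ : FormalOp d) (B : Finset ℤ) :
    restrict (adjoint Φ) B = (restrict Φ B)ᴴ := by
  simp only [restrict, Matrix.conjTranspose_sum, ← embed_conjTranspose]
  rfl

/-! ### The normalized trace -/

/-- The normalized trace `d^{-|B|} Tr`. -/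
noncomputable def ntr {B : Finset ℤ} (Y : Op d B) : ℂ := ((d : ℂ) ^ B.card)⁻¹ * Y.trace

theorem ntr_zero {B : Finset ℤ} : ntr (0 : Op d B) = 0 := by simp [ntr]

theorem ntr_sub {B : Finset ℤ} (X Y : Op d B) : ntr (X - Y) = ntr X - ntr Y := by
  simp [ntr, mul_sub]

theorem ntr_sum {B : Finset ℤ} {ι : Type*} (S : Finset ι) (f : ι → Op d B) :
    ntr (∑ i ∈ S, f i) = ∑ i ∈ S, ntr (f i) := by
  simp [ntr, Matrix.trace_sum, Finset.mul_sum]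

theorem ntr_mul_comm {B : Finset ℤ} (X Y : Op d B) : ntr (X * Y) = ntr (Y * X) := by
  rw [ntr, Matrix.trace_mul_comm, ntr]

theorem ntr_lie {B : Finset ℤ} (X Y : Op d B) : ntr ⁅X, Y⁆ = 0 := by
  rw [Ring.lie_def, ntr_sub, ntr_mul_comm, sub_self]

theorem ntr_conjTranspose {B : Finset ℤ} (X : Op d B) : ntr Xᴴ = star (ntr X) := by
  simp [ntr, Matrix.trace_conjTranspose]

theorem ntr_pull (x : ℤ) {B : Finset ℤ} (Y : Op d (shiftSet x B)) : ntr (pull x Y) = ntr Y := by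
  rw [ntr, ntr, card_shiftSet]
  congr 1
  exact (shiftConfigEquiv x B).sum_comp fun s => Y s s

theorem ntr_partialTrace [NeZero d] {C B : Finset ℤ} (h : C ⊆ B) (Y : Op d B) :
    ntr (partialTrace h Y) = ntr Y := by
  have hc : B.card = (B \ C).card + C.card := (Finset.card_sdiff_add_card_eq_card h).symm
  simp only [ntr, Matrix.trace, Matrix.diag_apply, sum_split h, partialTrace, Matrix.of_apply,
    ← Finset.mul_sum]
  rw [hc, pow_add, mul_inv]
  ring

open scoped ComplexOrder in
theorem ntr_conjTranspose_mul_self_eq_zero [NeZero d] {B : Finset ℤ} {Y : Op d B}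
    (h : ntr (Yᴴ * Y) = 0) : Y = 0 := by
  have hd : (d : ℂ) ^ B.card ≠ 0 := pow_ne_zero _ (NeZero.ne _)
  exact Matrix.trace_conjTranspose_mul_self_eq_zero_iff.1
    ((mul_eq_zero.1 h).resolve_left (inv_ne_zero hd))

/-- One of the two sets does not contain the other. Tracing down to that set first kills the other
factor, which is traceless at a site outside it; the case `C ⊆ A` is brought to this form by taking
adjoints. -/
theorem ntr_conjTranspose_embed_mul_embed [NeZero d] {A C B : Finset ℤ} (hA : A ⊆ B)
    (hC : C ⊆ B) (hne : A ≠ C) {X : Op d A} {Y : Op d C} (hX : X ∈ tracelessOp d A)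
    (hY : Y ∈ tracelessOp d C) : ntr ((embed hA X)ᴴ * embed hC Y) = 0 := by
  by_cases h : C ⊆ A
  · have h' : ¬ A ⊆ C := fun h' => hne (h'.antisymm h)
    have e : ntr ((embed hC Y)ᴴ * embed hA X) = 0 := by
      rw [← ntr_partialTrace hC, ← embed_conjTranspose, partialTrace_embed_mul,
        partialTrace_embed_traceless hA hC h' hX, mul_zero, ntr_zero]
    rw [← Matrix.conjTranspose_conjTranspose (embed hC Y), ← Matrix.conjTranspose_mul,
      ntr_conjTranspose, e, star_zero]
  · rw [← ntr_partialTrace hA, ← embed_conjTranspose, partialTrace_embed_mul,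
      partialTrace_embed_traceless hC hA h hY, mul_zero, ntr_zero]

/-- Formal operators with disjoint supports are orthogonal. -/
theorem ntr_restrict_eq_zero [NeZero d] {Φ Ψ : FormalOp d} (h : ∀ A, Φ A = 0 ∨ Ψ A = 0)
    (B : Finset ℤ) : ntr ((restrict Φ B)ᴴ * restrict Ψ B) = 0 := by
  rw [restrict, restrict, Matrix.conjTranspose_sum, Finset.sum_mul, ntr_sum]
  refine Finset.sum_eq_zero fun A _ => ?_
  rw [Finset.mul_sum, ntr_sum]
  refine Finset.sum_eq_zero fun C _ => ?_
  by_cases hAC : A = C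
  · subst hAC
    rcases h A.1 with h | h <;> simp [h, embed_zero, ntr_zero]
  · exact ntr_conjTranspose_embed_mul_embed _ _ (fun h => hAC (Subtype.ext h)) (Φ A.1).2
      (Ψ C.1).2

/-! ### The form `⟨Φ, [H, Ψ]⟩` in finite volume -/

/-- `Φ` has no terms outside `B`. -/
def IsSupportedIn (B : Finset ℤ) (Φ : FormalOp d) : Prop := ∀ A, Φ A ≠ 0 → A ⊆ B

theorem IsSupportedIn.restrict_eq {B M : Finset ℤ} {Φ : FormalOp d} (hΦ : IsSupportedIn B Φ)
    (h : B ⊆ M) : restrict Φ M = embed h (restrict Φ B) := by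
  rw [restrict_split Φ h, add_eq_left]
  refine Finset.sum_eq_zero fun A _ => ?_
  split_ifs with hA
  · rfl
  · have : Φ A.1 = 0 := by
      by_contra hne
      exact hA (hΦ A.1 hne)
    simp [this, embed_zero]

/-- The form `⟨Φ|_M, [H|_M, Ψ|_M]⟩` for the normalized Hilbert-Schmidt inner product. -/
noncomputable def commForm (H : FormalOp d) (M : Finset ℤ) (Φ Ψ : FormalOp d) : ℂ :=
  ntr ((restrict Φ M)ᴴ * ⁅restrict H M, restrict Ψ M⁆)

theorem commForm_eq_ntr_comm [NeZero d] {r : ℕ} {H : FormalOp d} (hH : IsAtMostLocal r H)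
    {B M : Finset ℤ} (hM : nbhd r B ⊆ M) {Φ : FormalOp d} (hΦ : IsSupportedIn B Φ)
    (Ψ : FormalOp d) :
    commForm H M Φ Ψ = ntr ((restrict Φ B)ᴴ * restrict (comm H Ψ) B) := by
  have hB : B ⊆ M := (subset_nbhd r B).trans hM
  rw [commForm, hΦ.restrict_eq hB, ← ntr_partialTrace hB, ← embed_conjTranspose,
    partialTrace_embed_mul, restrict_comm hH Ψ hB hM]

/-- Cyclicity of the trace makes `[H, ·]` symmetric for the Hilbert-Schmidt inner product when `H`
is Hermitian. -/
theorem commForm_star {H : FormalOp d} (hH : IsHermitian H) (M : Finset ℤ)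
    (Φ Ψ : FormalOp d) : star (commForm H M Φ Ψ) = commForm H M Ψ Φ := by
  have h : (restrict H M)ᴴ = restrict H M := by rw [← restrict_adjoint, hH]
  have key : ∀ X Z W : Op d M, Zᴴ = Z →
      star (ntr (Xᴴ * ⁅Z, W⁆)) = ntr (Wᴴ * ⁅Z, X⁆) := by
    intro X Z W hZ
    have h1 : ntr (Z * Wᴴ * X) = ntr (Wᴴ * (X * Z)) := by
      rw [mul_assoc, ntr_mul_comm, mul_assoc]
    rw [← ntr_conjTranspose, Ring.lie_def, Ring.lie_def, mul_sub, mul_sub,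
      Matrix.conjTranspose_sub, Matrix.conjTranspose_mul, Matrix.conjTranspose_mul,
      Matrix.conjTranspose_mul, Matrix.conjTranspose_mul, Matrix.conjTranspose_conjTranspose,
      hZ, ntr_sub, ntr_sub, h1, mul_assoc]
  exact key _ _ _ h

theorem commForm_translate {H : FormalOp d} (hH : IsTranslationInvariant H) (x : ℤ)
    (M : Finset ℤ) (Φ Ψ : FormalOp d) :
    commForm H M (translate x Φ) (translate x Ψ) = commForm H (shiftSet x M) Φ Ψ := by
  conv_lhs => rw [commForm, ← hH.translate_eq x]
  rw [restrict_translate, restrict_translate, restrict_translate, ← pull_lie,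
    ← pull_conjTranspose, ← pull_mul, ntr_pull, commForm]

/-- The form is independent of the volume once the second argument is well inside. -/
theorem commForm_eq_of_supported [NeZero d] {r : ℕ} {H : FormalOp d} (hH : IsAtMostLocal r H)
    (hH' : IsHermitian H) {B M M' : Finset ℤ} (hM : nbhd r B ⊆ M) (hM' : nbhd r B ⊆ M')
    {Φ Ψ : FormalOp d} (h : IsSupportedIn B Φ ∨ IsSupportedIn B Ψ) :
    commForm H M Φ Ψ = commForm H M' Φ Ψ := by
  rcases h with h | h
  · rw [commForm_eq_ntr_comm hH hM h, commForm_eq_ntr_comm hH hM' h]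
  · rw [← commForm_star hH', commForm_eq_ntr_comm hH hM h, ← commForm_eq_ntr_comm hH hM' h,
      commForm_star hH']

theorem commForm_translate_right [NeZero d] {r : ℕ} {H : FormalOp d} (hH : IsAtMostLocal r H)
    (hH' : IsHermitian H) (hT : IsTranslationInvariant H) {B : Finset ℤ} {Φ Ψ : FormalOp d}
    (hΦ : IsSupportedIn B Φ) (hΨ : IsSupportedIn B Ψ) (x : ℤ) :
    commForm H (nbhd r B) Φ (translate x Ψ)
      = commForm H (nbhd r B) (translate (-x) Φ) Ψ := by
  -- Both `M` and its shift by `x` contain `nbhd r B`, so the volume can be enlarged, translated and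
  -- shrunk back without changing the form.
  let M := nbhd r B ∪ shiftSet (-x) (nbhd r B)
  have hM : nbhd r B ⊆ shiftSet x M := by
    have := shiftSet_subset (x := x)
      (Finset.subset_union_right : shiftSet (-x) (nbhd r B) ⊆ M)
    rwa [shiftSet_shiftSet, neg_add_cancel, shiftSet_zero] at this
  rw [commForm_eq_of_supported hH hH' Finset.Subset.rfl
      (Finset.subset_union_left : nbhd r B ⊆ M) (Or.inl hΦ),
    commForm_eq_of_supported hH hH' Finset.Subset.rfl hM (Or.inr hΨ),
    ← commForm_translate hT, translate_translate, add_neg_cancel, translate_zero]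

/-! ### Densities of translation-invariant formal operators -/

open Classical in
/-- The part of a formal operator carried by the sets with least element `0`. -/
noncomputable def density (Φ : FormalOp d) : FormalOp d := fun A =>
  if IsLeast (A : Set ℤ) 0 then Φ A else 0

theorem isSupportedIn_density {r : ℕ} {Φ : FormalOp d} (hΦ : IsAtMostLocal r Φ) :
    IsSupportedIn (Finset.Icc 0 (r : ℤ)) (density Φ) := by
  intro A hA a ha
  rw [density] at hA
  split_ifs at hA with h
  · have h1 := hΦ A hA 0 h.1 a ha
    exact Finset.mem_Icc.2 ⟨h.2 ha, by omega⟩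
  · exact absurd rfl hA

/-- Exactly one translate of a nonempty `A` has least element `0`, so one summand survives. The
empty set has no least element, and its scalar component is lost; it is invisible to commutators. -/
theorem sum_translate_density {Φ : FormalOp d} (hΦ : IsTranslationInvariant Φ) {K : ℕ}
    {A : Finset ℤ} (hne : A.Nonempty) (hA : A ⊆ Finset.Icc (-K : ℤ) K) :
    (∑ x ∈ Finset.Icc (-K : ℤ) K, translate x (density Φ)) A = Φ A := by
  have hmin := Finset.isLeast_min' A hne
  have hK := Finset.mem_Icc.1 (hA (Finset.min'_mem A hne))
  have hiff : ∀ x, IsLeast (shiftSet x A : Set ℤ) 0 ↔ x = -A.min' hne := by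
    intro x
    constructor
    · intro h
      have h1 : 0 - x ∈ A := mem_shiftSet.1 h.1
      have h2 := h.2 (show A.min' hne + x ∈ (shiftSet x A : Set ℤ) from
        mem_shiftSet.2 (by simpa using Finset.min'_mem A hne))
      have h3 := Finset.min'_le A _ h1
      omega
    · rintro rfl
      refine ⟨mem_shiftSet.2 (by simpa using Finset.min'_mem A hne), fun a ha => ?_⟩
      have := Finset.min'_le A _ (mem_shiftSet.1 ha)
      omega
  rw [Finset.sum_apply, Finset.sum_eq_single (-A.min' hne)]
  · conv_rhs => rw [← hΦ.translate_eq (-A.min' hne)]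
    apply Subtype.ext
    rw [translate_apply, translate_apply, density, if_pos ((hiff _).2 rfl)]
  · intro x _ hx
    rw [translate_apply_eq_zero_iff, density, if_neg fun h => hx ((hiff x).1 h)]
  · intro h
    exact absurd (Finset.mem_Icc.2 ⟨by omega, by omega⟩) h

/-- A formal operator whose components on nonempty subsets of `M` agree with those of `Ψ` has
the same commutators in the volume `M`. -/
theorem lie_restrict_congr {M : Finset ℤ} {Φ Ψ : FormalOp d}
    (h : ∀ A : Finset ℤ, A.Nonempty → A ⊆ M → Φ A = Ψ A) (Z : Op d M) :
    ⁅Z, restrict Φ M⁆ = ⁅Z, restrict Ψ M⁆ := by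
  have hM : (∅ : Finset ℤ) ⊆ M := Finset.empty_subset M
  have e : restrict (Φ - Ψ) M = embed hM (restrict (Φ - Ψ) ∅) := by
    rw [restrict_split _ hM, add_eq_left]
    refine Finset.sum_eq_zero fun A _ => ?_
    split_ifs with hA
    · rfl
    · have : (Φ - Ψ) A.1 = 0 := by
        rw [Pi.sub_apply, h A.1 _ (Finset.mem_powerset.1 A.2), sub_self]
        exact Finset.nonempty_iff_ne_empty.2 fun h => hA h.subset
      simp [this, embed_zero]
  rw [← sub_eq_zero, ← lie_sub, ← restrict_sub, e, ← embed_self Finset.Subset.rfl Z]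
  exact embed_lie_eq_zero_of_disjoint _ _ (Finset.disjoint_empty_right M) _ _

theorem commForm_eq_sum {H Φ Ψ : FormalOp d} (hΨ : IsTranslationInvariant Ψ) {K : ℕ}
    {M : Finset ℤ} (hM : M ⊆ Finset.Icc (-K : ℤ) K) : commForm H M Φ Ψ
      = ∑ x ∈ Finset.Icc (-K : ℤ) K, commForm H M Φ (translate x (density Ψ)) := by
  have h := lie_restrict_congr (fun A hne hA => sum_translate_density hΨ hne (hA.trans hM))
    (restrict H M)
  simp only [commForm]
  rw [← h, restrict_sum, lie_sum, Finset.mul_sum, ntr_sum]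

/-! ### Semisimplicity of the adjoint action -/

theorem isTranslationInvariant_comm [NeZero d] {Φ Ψ : FormalOp d} (hΦ : IsLocal Φ)
    (h : IsTranslationInvariant Φ) (h' : IsTranslationInvariant Ψ) :
    IsTranslationInvariant (comm Φ Ψ) := by
  rw [IsTranslationInvariant, translate_comm hΦ, show translate 1 Φ = Φ from h,
    show translate 1 Ψ = Ψ from h']

/-- The component at `∅` is the normalized trace, which vanishes on commutators. -/
theorem comm_apply_empty [NeZero d] {Φ : FormalOp d} (hΦ : IsLocal Φ) (Ψ : FormalOp d) :
    comm Φ Ψ ∅ = 0 := by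
  obtain ⟨r, hr⟩ := hΦ
  have h := restrict_comm hr Ψ (subset_nbhd r ∅) Finset.Subset.rfl
  have hz : restrict (comm Φ Ψ) ∅ = 0 := by
    have ht : ntr (restrict (comm Φ Ψ) ∅) = 0 := by rw [h, ntr_partialTrace, ntr_lie]
    ext s t
    rw [Subsingleton.elim t s]
    simpa [ntr, Matrix.trace, Subsingleton.elim _ s] using ht
  apply Subtype.ext
  rw [← component_restrict _ Finset.Subset.rfl, hz, component_zero]
  rfl

/-- A Hermitian translation-invariant `H` acts semisimply on translation-invariant local formal
operators: what commutes with `H` after one commutator with `H` commutes with `H`. -/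
theorem comm_eq_zero_of_comm_comm_eq_zero [NeZero d] {H Y : FormalOp d} (hH : IsLocal H)
    (hH' : IsHermitian H) (hT : IsTranslationInvariant H) (hY : IsLocal Y)
    (hYT : IsTranslationInvariant Y) (h : comm H (comm H Y) = 0) : comm H Y = 0 := by
  set C := comm H Y with hC
  have hCT : IsTranslationInvariant C := isTranslationInvariant_comm hH hT hYT
  have hC0 : C ∅ = 0 := comm_apply_empty hH Y
  obtain ⟨s₁, hs₁⟩ := isLocal_comm hH hY
  obtain ⟨s₂, hs₂⟩ := hY
  obtain ⟨r, hr⟩ := hH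
  set s := max s₁ s₂
  set B : Finset ℤ := Finset.Icc 0 (s : ℤ)
  have hcB : IsSupportedIn B (density C) :=
    isSupportedIn_density (hs₁.mono (le_max_left _ _))
  have hyB : IsSupportedIn B (density Y) :=
    isSupportedIn_density (hs₂.mono (le_max_right _ _))
  -- The window of translations contains `nbhd r B` and is symmetric under `x ↦ -x`, as the
  -- reindexing below requires.
  set K := s + r
  have hM : nbhd r B ⊆ Finset.Icc (-K : ℤ) K := by
    intro a ha
    obtain ⟨b, hb, hab⟩ := Finset.mem_biUnion.1 ha
    have h1 := Finset.mem_Icc.1 hb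
    have h2 := Finset.mem_Icc.1 hab
    exact Finset.mem_Icc.2 ⟨by omega, by omega⟩
  -- With `c` and `y` the densities of `C` and `Y`: expand `⟨c, [H, Y]⟩` over translates of `y`,
  -- move each translation onto `c`, conjugate, and resum to the conjugate of `⟨y, [H, C]⟩`, which
  -- is zero.
  have key : ntr ((restrict (density C) B)ᴴ * restrict C B) = 0 := by
    rw [hC, ← commForm_eq_ntr_comm hr Finset.Subset.rfl hcB, commForm_eq_sum hYT hM]
    have e : ∀ x ∈ Finset.Icc (-K : ℤ) K,
        commForm H (nbhd r B) (density C) (translate x (density Y))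
          = star (commForm H (nbhd r B) (density Y) (translate (-x) (density C))) := by
      intro x _
      rw [commForm_translate_right hr hH' hT hcB hyB, commForm_star hH']
    rw [Finset.sum_congr rfl e, ← star_sum, star_eq_zero]
    rw [Finset.sum_nbij' (t := Finset.Icc (-K : ℤ) K)
      (g := fun x => commForm H (nbhd r B) (density Y) (translate x (density C)))
      (fun x => -x) (fun x => -x), ← commForm_eq_sum hCT hM,
      commForm_eq_ntr_comm hr Finset.Subset.rfl hyB, h, restrict_zero, mul_zero, ntr_zero]
    · intro x hx
      rw [Finset.mem_Icc] at hx ⊢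
      omega
    · intro x hx
      rw [Finset.mem_Icc] at hx ⊢
      omega
    · intro x _
      exact neg_neg x
    · intro x _
      exact neg_neg x
    · intro x _
      rfl
  -- The density of `C` is orthogonal to the rest of `C`, so `key` says that its own norm vanishes.
  have hzero : restrict (density C) B = 0 := by
    refine ntr_conjTranspose_mul_self_eq_zero ?_
    have := ntr_restrict_eq_zero (Φ := density C) (Ψ := C - density C) (fun A => ?_) B
    · rwa [restrict_sub, mul_sub, ntr_sub, key, zero_sub, neg_eq_zero] at this
    · by_cases hA : IsLeast (A : Set ℤ) 0
      · exact Or.inr (by simp [density, hA])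
      · exact Or.inl (by simp [density, hA])
  have hdens : density C = 0 := by
    funext A
    by_contra hA
    apply hA
    apply Subtype.ext
    rw [← component_restrict _ (hcB A hA), hzero, component_zero]
    rfl
  funext A
  rcases A.eq_empty_or_nonempty with rfl | hne
  · exact hC0
  · obtain ⟨L, hL⟩ : ∃ L : ℕ, A ⊆ Finset.Icc (-L : ℤ) L := by
      refine ⟨A.sup Int.natAbs, fun a ha => ?_⟩
      have : a.natAbs ≤ A.sup Int.natAbs := Finset.le_sup ha
      exact Finset.mem_Icc.2 ⟨by omega, by omega⟩
    rw [← sum_translate_density hCT hne hL, hdens]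
    simp [translate_zero_right]

/-! ### The charges -/

theorem charge_isLocal [NeZero d] {B H : FormalOp d} (hB : IsLocal B) (hH : IsLocal H)
    {n : ℕ} (hn : 2 ≤ n) : IsLocal (charge B H n) := by
  induction n, hn using Nat.le_induction with
  | base => exact hH
  | succ n hn ih =>
    rw [charge_succ B H hn]
    exact isLocal_comm hB ih

/-- Subtracting `[H, [B, H]] = 0` from its translate leaves `[H, [X, H]] = 0`, to which
semisimplicity applies. -/
theorem comm_hamiltonian_boost_increment [NeZero d] {H B : FormalOp d} (hH : IsLocal H)
    (hH' : IsHermitian H) (hT : IsTranslationInvariant H) (hB : IsLocal B)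
    (hQ : comm H (comm B H) = 0)
    (hX : IsTranslationInvariant (translate 1 B - B)) : comm H (translate 1 B - B) = 0 := by
  have hXl : IsLocal (translate 1 B - B) := isLocal_sub (translate_isLocal hB 1) hB
  refine comm_eq_zero_of_comm_comm_eq_zero hH hH' hT hXl hX ?_
  have h1 : comm H (comm (translate 1 B) H) = 0 := by
    have := congrArg (translate 1) hQ
    rwa [translate_comm hH, translate_comm hB, show translate 1 H = H from hT,
      translate_zero_right] at this
  have h2 : comm (translate 1 B) H = comm B H + comm (translate 1 B - B) H := by
    rw [← add_comm_left hB hXl hH, add_sub_cancel]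
  rw [h2, comm_add hH, hQ, zero_add] at h1
  rw [comm_swap hH hXl, comm_neg hH, h1, neg_zero]

theorem charge_translationInvariant_and_comm [NeZero d] {H B X : FormalOp d} (hH : IsLocal H)
    (hT : IsTranslationInvariant H) (hB : IsLocal B) (hX : translate 1 B = B + X)
    (hXl : IsLocal X) (hX' : IsHermitian X) (hXT : IsTranslationInvariant X)
    (hXH : comm X H = 0) (hXBX : comm X (comm B X) = 0) {n : ℕ} (hn : 2 ≤ n) :
    IsTranslationInvariant (charge B H n) ∧ comm X (charge B H n) = 0 := by
  induction n, hn using Nat.le_induction with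
  | base => exact ⟨hT, hXH⟩
  | succ n hn ih =>
    have hQ : IsLocal (charge B H n) := charge_isLocal hB hH hn
    rw [charge_succ B H hn]
    have hinv : IsTranslationInvariant (comm B (charge B H n)) := by
      rw [IsTranslationInvariant, translate_comm hB, hX, show translate 1 (charge B H n) = _
        from ih.1, add_comm_left hB hXl hQ, ih.2, add_zero]
    refine ⟨hinv, comm_eq_zero_of_comm_comm_eq_zero hXl hX' hXT (isLocal_comm hB hQ) hinv ?_⟩
    have hY : IsLocal (comm B X) := isLocal_comm hB hXl
    -- Since `[X, Q] = 0`, `h1` turns `[X, [B, Q]]` into `-[[B, X], Q]`, and `h2` shows that `X`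
    -- commutes with `[[B, X], Q]`.
    have h1 := comm_jacobi hB hXl hQ
    have h2 := comm_jacobi hXl hY hQ
    rw [ih.2, comm_zero hB] at h1
    rw [ih.2, comm_zero hY, add_zero, hXBX, zero_comm] at h2
    have h3 : comm X (comm B (charge B H n)) = -comm (comm B X) (charge B H n) := by
      rw [eq_neg_iff_add_eq_zero, add_comm]
      exact h1.symm
    rw [h3, comm_neg hXl, h2, neg_zero]

theorem comm_charge_charge [NeZero d] {H B : FormalOp d} (hH : IsLocal H)
    (hH' : IsHermitian H) (hB : IsLocal B)
    (hT : ∀ n, 2 ≤ n → IsTranslationInvariant (charge B H n))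
    (hQ : comm H (charge B H 3) = 0) {m n : ℕ} (hm : 2 ≤ m) (hn : 2 ≤ n) :
    comm (charge B H m) (charge B H n) = 0 := by
  have hl : ∀ {k}, 2 ≤ k → IsLocal (charge B H k) := fun hk => charge_isLocal hB hH hk
  suffices h : ∀ N a b : ℕ, 2 ≤ a → 2 ≤ b → a + b = N →
      comm (charge B H a) (charge B H b) = 0 from h _ m n hm hn rfl
  intro N
  induction N using Nat.strong_induction_on with
  | _ N ih =>
    -- Apply `[B, ·]` to the vanishing commutator of index sum `N - 1`: an index moves across at the
    -- cost of a sign.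
    have step : ∀ a b : ℕ, 2 ≤ a → 2 ≤ b → a + b + 1 = N →
        comm (charge B H (a + 1)) (charge B H b) = -comm (charge B H a) (charge B H (b + 1)) := by
      intro a b ha hb hab
      have h1 := comm_jacobi hB (hl ha) (hl hb)
      rw [ih (a + b) (by omega) a b ha hb rfl, comm_zero hB, ← charge_succ B H ha,
        ← charge_succ B H hb] at h1
      exact eq_neg_of_add_eq_zero_left h1.symm
    have base : ∀ b : ℕ, 2 ≤ b → 2 + b = N → comm (charge B H 2) (charge B H b) = 0 := by
      intro b hb hbN
      rcases hb.eq_or_lt with rfl | hb'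
      · exact comm_self hH
      rcases (show 3 ≤ b from hb').eq_or_lt with rfl | hb''
      · exact hQ
      obtain ⟨c, rfl⟩ : ∃ c, b = c + 1 := ⟨b - 1, by omega⟩
      refine comm_eq_zero_of_comm_comm_eq_zero hH hH' (hT 2 le_rfl) (hl hb) (hT _ hb) ?_
      have h1 := step 2 c le_rfl (by omega) (by omega)
      -- `H` commutes with both entries, with the second by induction, hence with their commutator.
      -- By `h1` this is `[H, [H, Q⁽ᶜ⁺¹⁾]] = 0`.
      have h2 : comm H (comm (charge B H 3) (charge B H c)) = 0 := by
        have h3 : comm H (charge B H c) = 0 :=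
          ih (2 + c) (by omega) 2 c le_rfl (by omega) rfl
        have hc : IsLocal (charge B H c) := hl (by omega)
        rw [comm_jacobi hH (hl (by norm_num)) hc, hQ, h3, zero_comm,
          comm_zero (hl (by norm_num)), add_zero]
      rw [show charge B H (2 + 1) = charge B H 3 from rfl] at h1
      rw [h1, comm_neg hH, neg_eq_zero] at h2
      exact h2
    intro a b ha
    -- Lower the first index to `2` at fixed sum `N`, which is why `b` is generalized.
    induction a, ha using Nat.le_induction generalizing b with
    | base => exact base b
    | succ a ha iha =>
      intro hb hab
      rw [step a b ha hb (by omega), iha (b + 1) (by omega) (by omega), neg_zero]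

end SpinChain

/-! ### The commuting hierarchy -/

theorem proposition2 (d : ℕ) [NeZero d] (H B X : SpinChain.FormalOp d)
    (hH_local : SpinChain.IsLocal H)
    (hH_herm : SpinChain.IsHermitian H)
    (hH_inv : SpinChain.IsTranslationInvariant H)
    (hB_local : SpinChain.IsLocal B)
    (hB_herm : SpinChain.IsHermitian B)
    (hX_def : X = SpinChain.translate 1 B - B)
    (hQ3 : SpinChain.comm H (SpinChain.charge B H 3) = 0)
    (hX_inv : SpinChain.IsTranslationInvariant X)
    (hXBX : SpinChain.comm X (SpinChain.comm B X) = 0) :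
    (∀ n : ℕ, 2 ≤ n → SpinChain.IsTranslationInvariant (SpinChain.charge B H n)) ∧
    (∀ m n : ℕ, 2 ≤ m → 2 ≤ n →
      SpinChain.comm (SpinChain.charge B H m) (SpinChain.charge B H n) = 0) ∧
    (∀ n : ℕ, 2 ≤ n → SpinChain.comm X (SpinChain.charge B H n) = 0) := by
  have hXl : SpinChain.IsLocal X := by
    rw [hX_def]
    exact SpinChain.isLocal_sub (SpinChain.translate_isLocal hB_local 1) hB_local
  -- Hermiticity of `X` is what lets semisimplicity be applied to `[X, ·]`.
  have hXh : SpinChain.IsHermitian X := by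
    rw [hX_def, SpinChain.IsHermitian, SpinChain.adjoint_sub, SpinChain.adjoint_translate,
      show SpinChain.adjoint B = B from hB_herm]
  have hHX : SpinChain.comm H X = 0 := by
    rw [hX_def] at hX_inv ⊢
    exact SpinChain.comm_hamiltonian_boost_increment hH_local hH_herm hH_inv hB_local hQ3 hX_inv
  have hXH : SpinChain.comm X H = 0 := by
    rw [SpinChain.comm_swap hXl hH_local, hHX, neg_zero]
  have hX : SpinChain.translate 1 B = B + X := by rw [hX_def, add_sub_cancel]
  have main := fun n (hn : 2 ≤ n) => SpinChain.charge_translationInvariant_and_comm hH_local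
    hH_inv hB_local hX hXl hXh hX_inv hXH hXBX hn
  exact ⟨fun n hn => (main n hn).1, fun m n hm hn => SpinChain.comm_charge_charge hH_local
    hH_herm hB_local (fun n hn => (main n hn).1) hQ3 hm hn, fun n hn => (main n hn).2⟩
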